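/- Fix $d,\gamma,h>0$ and let $x=(\tilde p,\tilde v,a_d,\eta)\in\mathbb R^4$. Let $x^+=A_dx+B_du$, $u\in\mathbb R$, be the exact zero-order-hold discretization with sampling period $h$ of $$\dot{\tilde p}=\tilde v,\quad \dot{\tilde v}=-d\tilde v+a_d,\quad \dot a_d=-\tfrac1\gamma(a_d-\eta),\quad \dot\eta=-\tfrac1\gamma(\eta-u).$$ Let $\Delta:[0,\infty)\to(0,\infty)$ and, for $i,k\in\mathbb N_0$, put $\Delta_{i|k}=\inf\{\Delta(t): t\in[(k+i)h,(k+i+1)h]\}$ and $\Delta(k)=\Delta_{0|k}$. Put $\alpha=e^{-h/\gamma}$, $\beta=\frac h\gamma e^{-h/\gamma}$, and assume $$\Delta(k+1)>e^{-h/\gamma}\left(1+\tfrac h\gamma\right)\Delta(k)\qquad\text{for all }k\in\mathbb N_0 .$$ Let $N\ge1$, let $Q\in\mathbb R^{4\times4}$ be symmetric positive definite and $R>0$. Let $M_c\succ0$ satisfy $A_d^{\mathsf T}M_cA_d-M_c\preceq0$, let $\kappa>0$ satisfy $\kappa B_d^{\mathsf T}M_cB_d<1$, put $K=-\kappa B_d^{\mathsf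 T}M_cA_d$, and let $M_q\succ0$ satisfy $(A_d+B_dK)^{\mathsf T}M_q(A_d+B_dK)-M_q=-I$. Let $$\Delta^*=\min\Big\{\tfrac{\inf_k[\Delta(k+1)-(\alpha+\beta)\Delta(k)]}{1-\alpha-\beta},\ \tfrac{\inf_k[\Delta(k+1)-\alpha\Delta(k)]}{1-\alpha},\ \inf_k\Delta(k)\Big\},$$ let $L_u$ satisfy $\Delta^*L_u>1$, and let $$\lambda=\frac{2\kappa L_u\,\sigma_{\max}(A_d^{\mathsf T}M_qB_d)}{\sqrt{\lambda_{\min}(M_c)}},\qquad \Theta>0,\quad \Theta\ge\lambda_{\max}\big(Q+\kappa^2A_d^{\mathsf T}M_cB_dRB_d^{\mathsf T}M_cA_d\big).$$ At time $k$ and state $x$ consider the problem of minimizing $$\Theta\big[x_{N|k}^{\mathsf T}M_qx_{N|k}+\lambda(x_{N|k}^{\mathsf T}M_cx_{N|k})^{3/2}\big]+\sum_{i=0}^{N-1}\big(x_{i|k}^{\mathsf T}Qx_{i|k}+R\,u_{i|k}^2\big)$$ over $(u_{0|k},\dots,u_{N-1|k})$ subject to $x_{0|k}=x$, $x_{i+1|k}=A_dx_{i|k}+B_du_{i|k}$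 and $u_{\min,i|k}\le u_{i|k}\le u_{\max,i|k}$ for $0\le i<N$. Here, with $a_{i|k},\eta_{i|k}$ the third and fourth coordinates of $x_{i|k}$, $$u_{\max,i|k}=\min\Big\{\Delta_{i|k},\ \tfrac{\Delta_{i+1|k}-\alpha a_{i|k}-\beta\eta_{i|k}}{1-\alpha-\beta},\ \tfrac{\Delta_{i+1|k}-\alpha\eta_{i|k}}{1-\alpha}\Big\},$$ $$u_{\min,i|k}=\max\Big\{-\Delta_{i|k},\ \tfrac{-\Delta_{i+1|k}-\alpha a_{i|k}-\beta\eta_{i|k}}{1-\alpha-\beta},\ \tfrac{-\Delta_{i+1|k}-\alpha\eta_{i|k}}{1-\alpha}\Big\}.$$ Let $\mathcal F_k\subseteq\mathbb R^4$ be the set of states for which this problem is feasible at time $k$. Then: 1. every $x$ with $|a_d|\le\Delta(k)$ and $|\eta|\le\Delta(k)$ (with $\tilde p,\tilde v$ arbitrary) belongs to $\mathcal F_k$; 2. for all $k$ and $x\in\mathcal F_k$ the minimum is attained, so an MPC law $k_N(k,x)$, the first input of an optimal sequence, exists; 3. for every such law, the closed loop $x(k+1)=A_dx(k)+B_dk_N(k,x(k))$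 is uniformly globally asymptotically stable on $(\mathcal F_k)_{k\ge0}$. That is, $0\in\mathcal F_k$ for all $k$; $x(k)\in\mathcal F_k$ implies $x(k+1)\in\mathcal F_{k+1}$; there is $\delta:\mathbb R\to\mathbb R$, positive on $(0,\infty)$ and with $\delta(\varepsilon)\to\infty$ as $\varepsilon\to\infty$, such that for every $\varepsilon>0$ and every solution starting at a time $k_0\ge 0$ in $\mathcal F_{k_0}$, $\|x(k_0)\|<\delta(\varepsilon)$ implies $\|x(k)\|<\varepsilon$ for all $k\ge k_0$; and for all $\rho,c>0$ there is $T\in\mathbb N_0$ such that for every such solution $\|x(k_0)\|<c$ implies $\|x(k)\|<\rho$ for all $k\ge k_0+T$. -/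

import Mathlib

open scoped Matrix

noncomputable section

namespace AxisMPC

/-- Single-axis states, in the order: position error, velocity error, desired acceleration `a_d`
(coordinate 2), and filter state `η` (coordinate 3). -/
abbrev State : Type := Fin 4 → ℝ

/-! ### The single-axis model and its exact zero-order-hold discretization -/

/-- State matrix of `p' = v`, `v' = -d v + a_d`, `a_d' = -(a_d - η)/γ`, `η' = -(η - s)/γ`. -/
def Acont (d γ : ℝ) : Matrix (Fin 4) (Fin 4) ℝ :=
  !![0, 1, 0, 0;
     0, -d, 1, 0;
     0, 0, -(1 / γ), 1 / γ;
     0, 0, 0, -(1 / γ)]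

/-- Input matrix of the same continuous-time model, with scalar input `s`. -/
def Bcont (γ : ℝ) : Matrix (Fin 4) (Fin 1) ℝ :=
  !![0; 0; 0; 1 / γ]

/-- `A_d = exp (h A)`. -/
def Ad (d γ h : ℝ) : Matrix (Fin 4) (Fin 4) ℝ :=
  NormedSpace.exp (h • Acont d γ)

/-- `B_d = (∫₀ʰ exp (s A) ds) B`, entrywise. -/
def Bd (d γ h : ℝ) : Matrix (Fin 4) (Fin 1) ℝ :=
  Matrix.of fun i j => ∫ s in (0 : ℝ)..h, (NormedSpace.exp (s • Acont d γ) * Bcont γ) i j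

/-- One step `x⁺ = A x + B u` with scalar input `u`. -/
def step (A : Matrix (Fin 4) (Fin 4) ℝ) (B : Matrix (Fin 4) (Fin 1) ℝ) (x : State) (u : ℝ) :
    State :=
  A *ᵥ x + B *ᵥ (fun _ => u)

/-! ### Extreme eigenvalues and singular values -/

/-- Largest eigenvalue of a (symmetric) real matrix. -/
def lamMax {n : Type*} [Fintype n] [DecidableEq n] (M : Matrix n n ℝ) : ℝ :=
  sSup (spectrum ℝ M)

/-- Smallest eigenvalue of a (symmetric) real matrix. -/
def lamMin {n : Type*} [Fintype n] [DecidableEq n] (M : Matrix n n ℝ) : ℝ :=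
  sInf (spectrum ℝ M)

/-- Largest singular value of a real matrix. -/
def sigmaMax {m n : Type*} [Fintype m] [Fintype n] [DecidableEq n] (M : Matrix m n ℝ) : ℝ :=
  Real.sqrt (lamMax (Mᵀ * M))

/-- Euclidean norm of a state. -/
def eucl (x : State) : ℝ :=
  Real.sqrt (x ⬝ᵥ x)

/-- Quadratic form `xᵀ M x`. -/
def quad (M : Matrix (Fin 4) (Fin 4) ℝ) (x : State) : ℝ :=
  x ⬝ᵥ (M *ᵥ x)

/-! ### Time-varying bounds -/

/-- `Δ_{i|k}`, the infimum of `Δ(t)` over `t ∈ [(k+i) h, (k+i+1) h]` (a minimum if `Δ` is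
continuous). -/
def boundAt (Δ : ℝ → ℝ) (h : ℝ) (i k : ℕ) : ℝ :=
  sInf (Δ '' Set.Icc (((k : ℝ) + i) * h) (((k : ℝ) + i + 1) * h))

/-- `α = exp (-h/γ)`. -/
def alpha (h γ : ℝ) : ℝ :=
  Real.exp (-(h / γ))

/-- `β = (h/γ) exp (-h/γ)`. -/
def beta (h γ : ℝ) : ℝ :=
  h / γ * Real.exp (-(h / γ))

/-- The lower input bound at prediction step `i` of sampling instant `k`, where `x` is the
predicted state at that step. -/
def uMin (Δ : ℝ → ℝ) (h γ : ℝ) (i k : ℕ) (x : State) : ℝ :=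
  max (-boundAt Δ h i k)
    (max
      ((1 - alpha h γ - beta h γ)⁻¹ *
        (-boundAt Δ h (i + 1) k - (alpha h γ * x 2 + beta h γ * x 3)))
      (-((1 - alpha h γ)⁻¹ * (boundAt Δ h (i + 1) k + alpha h γ * x 3))))

/-- The upper input bound at prediction step `i` of sampling instant `k`, where `x` is the
predicted state at that step. -/
def uMax (Δ : ℝ → ℝ) (h γ : ℝ) (i k : ℕ) (x : State) : ℝ :=
  min (boundAt Δ h i k)
    (min
      ((1 - alpha h γ - beta h γ)⁻¹ *
        (boundAt Δ h (i + 1) k - (alpha h γ * x 2 + beta h γ * x 3)))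
      ((1 - alpha h γ)⁻¹ * (boundAt Δ h (i + 1) k - alpha h γ * x 3)))

/-- The constant `Δ*`, with `Δ(k) = Δ_{0|k}`. -/
def deltaStar (Δ : ℝ → ℝ) (h γ : ℝ) : ℝ :=
  min
    ((1 - alpha h γ - beta h γ)⁻¹ *
      ⨅ k : ℕ, (boundAt Δ h 0 (k + 1) - (alpha h γ + beta h γ) * boundAt Δ h 0 k))
    (min
      ((1 - alpha h γ)⁻¹ * ⨅ k : ℕ, (boundAt Δ h 0 (k + 1) - alpha h γ * boundAt Δ h 0 k))
      (⨅ k : ℕ, boundAt Δ h 0 k))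

/-! ### The finite-horizon optimization problem -/

/-- The predicted states `x_{i|k}` (meaningful for `i ≤ N`) from `x_{0|k} = x` under the input
sequence `U = (u_{0|k}, …, u_{N-1|k})`. -/
def pred (A : Matrix (Fin 4) (Fin 4) ℝ) (B : Matrix (Fin 4) (Fin 1) ℝ) {N : ℕ}
    (x : State) (U : Fin N → ℝ) : ℕ → State
  | 0 => x
  | i + 1 => step A B (pred A B x U i) (if hi : i < N then U ⟨i, hi⟩ else 0)

/-- The input sequence `U` satisfies all input constraints at sampling instant `k` from `x`. -/
def Feasible (Δ : ℝ → ℝ) (d γ h : ℝ) {N : ℕ} (k : ℕ) (x : State) (U : Fin N → ℝ) : Prop :=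
  ∀ i : Fin N,
    uMin Δ h γ i k (pred (Ad d γ h) (Bd d γ h) x U i) ≤ U i ∧
      U i ≤ uMax Δ h γ i k (pred (Ad d γ h) (Bd d γ h) x U i)

/-- The states from which the optimization problem at sampling instant `k` is feasible. -/
def feasibleStates (Δ : ℝ → ℝ) (d γ h : ℝ) (N k : ℕ) : Set State :=
  {x | ∃ U : Fin N → ℝ, Feasible Δ d γ h k x U}

/-- Terminal cost `V(x) = Θ [xᵀ M_q x + lam (xᵀ M_c x)^{3/2}]`. -/
def termCost (Mc Mq : Matrix (Fin 4) (Fin 4) ℝ) (lam Θ : ℝ) (x : State) : ℝ :=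
  Θ * (quad Mq x + lam * (quad Mc x) ^ (3 / 2 : ℝ))

/-- Total cost `V(x_{N|k}) + ∑_{i<N} (x_{i|k}ᵀ Q x_{i|k} + R u_{i|k}²)`. -/
def cost (A : Matrix (Fin 4) (Fin 4) ℝ) (B : Matrix (Fin 4) (Fin 1) ℝ)
    (Q : Matrix (Fin 4) (Fin 4) ℝ) (R : ℝ) (V : State → ℝ) {N : ℕ}
    (x : State) (U : Fin N → ℝ) : ℝ :=
  V (pred A B x U N) + ∑ i : Fin N, (quad Q (pred A B x U i) + U i * R * U i)

/-- `U` is an optimal input sequence at sampling instant `k` from `x`. -/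
def IsOptimal (Δ : ℝ → ℝ) (d γ h : ℝ) (Q : Matrix (Fin 4) (Fin 4) ℝ) (R : ℝ) (V : State → ℝ)
    {N : ℕ} (k : ℕ) (x : State) (U : Fin N → ℝ) : Prop :=
  Feasible Δ d γ h k x U ∧
    ∀ U' : Fin N → ℝ, Feasible Δ d γ h k x U' →
      cost (Ad d γ h) (Bd d γ h) Q R V x U ≤ cost (Ad d γ h) (Bd d γ h) Q R V x U'

/-- `kN` is an MPC law: wherever the problem is feasible, `kN k x` is the first input of an
optimal input sequence at sampling instant `k` from `x`. -/
def IsMPCLaw (Δ : ℝ → ℝ) (d γ h : ℝ) (Q : Matrix (Fin 4) (Fin 4) ℝ) (R : ℝ) (V : State → ℝ)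
    (N : ℕ) (hN : 0 < N) (kN : ℕ → State → ℝ) : Prop :=
  ∀ k : ℕ, ∀ x ∈ feasibleStates Δ d γ h N k,
    ∃ U : Fin N → ℝ, IsOptimal Δ d γ h Q R V k x U ∧ kN k x = U ⟨0, hN⟩

/-! ### Uniform global asymptotic stability -/

/-- `x` solves `x(k+1) = f(k, x(k))` from time `k₀` on. -/
def IsSolution (f : ℕ → State → State) (k₀ : ℕ) (x : ℕ → State) : Prop :=
  ∀ k, k₀ ≤ k → x (k + 1) = f k (x k)

/-- The origin of the time-varying system `x(k+1) = f(k, x(k))`, whose state space at time `k` is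
`D k`, is uniformly globally asymptotically stable: `D` is forward invariant, the origin is
uniformly stable with a modulus `δ(ε)` tending to infinity with `ε`, and solutions converge to the
origin uniformly in the initial time and in bounded sets of initial states. -/
def UGAS (D : ℕ → Set State) (f : ℕ → State → State) : Prop :=
  (∀ k, (0 : State) ∈ D k) ∧
  (∀ k, ∀ x ∈ D k, f k x ∈ D (k + 1)) ∧
  (∃ δ : ℝ → ℝ, (∀ ε, 0 < ε → 0 < δ ε) ∧ Filter.Tendsto δ Filter.atTop Filter.atTop ∧
    ∀ ε, 0 < ε → ∀ (k₀ : ℕ) (x : ℕ → State), x k₀ ∈ D k₀ → IsSolution f k₀ x →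
      eucl (x k₀) < δ ε → ∀ k, k₀ ≤ k → eucl (x k) < ε) ∧
  (∀ η c : ℝ, 0 < η → 0 < c → ∃ T : ℕ,
    ∀ (k₀ : ℕ) (x : ℕ → State), x k₀ ∈ D k₀ → IsSolution f k₀ x →
      eucl (x k₀) < c → ∀ k, k₀ + T ≤ k → eucl (x k) < η)

end AxisMPC

end

open scoped Matrix

noncomputable section

namespace AxisMPC

/-! ### Quadratic forms and extreme eigenvalues -/

section Spectral

variable {n : Type*} [Fintype n] [DecidableEq n] {M : Matrix n n ℝ}

/-! The optimal value of the finite-horizon problem is a Lyapunov function for the closed loop. The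
last two rows of the discretization are explicit, so the input constraints say exactly that `u`
obeys the bound of its own step and that the two acceleration coordinates of the successor obey the
bound of the next step (`admissible_iff`). From a state in the box, every `u` with `|u| ≤ deltaStar`
qualifies (`admissible_of_abs_le_deltaStar`).

The terminal cost pays for the linear feedback saturated at that level (`exists_termCost_step_le`).
The `Mq` part decreases as it would without saturation, up to a defect proportional to the cut-off
part of the input times the norm of the state; the decrease of the `3/2` power of the `Mc` form
absorbs this defect. Iterating the saturated law gives feasibility from the box. Appending it to an
optimal sequence with its first input dropped (`exists_shift_trajCost_le`) gives recursive
feasibility and a decrease of the value by the first stage cost.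

A feasible state may lie outside the box, where the terminal law is not available. An admissible
input of size linear in the state still exists there (`exists_admissible_abs_le`) and leads into the
box, so the value is at most quadratic plus cubic in the norm, uniformly in time. `ugas_of_lyapunov`
then concludes. -/

lemma finite_spectrum_of_isHermitian (hM : M.IsHermitian) : (spectrum ℝ M).Finite := by
  rw [hM.spectrum_real_eq_range_eigenvalues]
  exact Set.finite_range _

lemma dotProduct_mulVec_le_lamMax (hM : M.IsHermitian) (x : n → ℝ) :
    x ⬝ᵥ (M *ᵥ x) ≤ lamMax M * (x ⬝ᵥ x) := by
  have hpsd : (algebraMap ℝ (Matrix n n ℝ) (lamMax M) - M).PosSemidef := by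
    rw [Matrix.posSemidef_iff_isHermitian_and_spectrum_nonneg]
    refine ⟨?_, ?_⟩
    · refine Matrix.IsHermitian.sub ?_ hM
      rw [Matrix.algebraMap_eq_diagonal]
      exact Matrix.isHermitian_diagonal _
    · intro r hr
      rw [← spectrum.singleton_sub_eq] at hr
      obtain ⟨_, rfl, s, hs, rfl⟩ := hr
      exact sub_nonneg.2 (le_csSup (finite_spectrum_of_isHermitian hM).bddAbove hs)
  have h := hpsd.dotProduct_mulVec_nonneg x
  simp only [star_trivial, Matrix.sub_mulVec, dotProduct_sub, Algebra.algebraMap_eq_smul_one,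
    Matrix.smul_mulVec, Matrix.one_mulVec, dotProduct_smul, smul_eq_mul] at h
  linarith

lemma lamMin_le_dotProduct_mulVec (hM : M.IsHermitian) (x : n → ℝ) :
    lamMin M * (x ⬝ᵥ x) ≤ x ⬝ᵥ (M *ᵥ x) := by
  have hpsd : (M - algebraMap ℝ (Matrix n n ℝ) (lamMin M)).PosSemidef := by
    rw [Matrix.posSemidef_iff_isHermitian_and_spectrum_nonneg]
    refine ⟨?_, ?_⟩
    · refine Matrix.IsHermitian.sub hM ?_
      rw [Matrix.algebraMap_eq_diagonal]
      exact Matrix.isHermitian_diagonal _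
    · intro r hr
      rw [← spectrum.sub_singleton_eq] at hr
      obtain ⟨s, hs, _, rfl, rfl⟩ := hr
      exact sub_nonneg.2 (csInf_le (finite_spectrum_of_isHermitian hM).bddBelow hs)
  have h := hpsd.dotProduct_mulVec_nonneg x
  simp only [star_trivial, Matrix.sub_mulVec, dotProduct_sub, Algebra.algebraMap_eq_smul_one,
    Matrix.smul_mulVec, Matrix.one_mulVec, dotProduct_smul, smul_eq_mul] at h
  linarith

/-- The spectrum is finite and nonempty, so its infimum is itself an eigenvalue. -/
lemma lamMin_pos [Nonempty n] (hM : M.PosDef) : 0 < lamMin M := by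
  have hne : (spectrum ℝ M).Nonempty := by
    rw [hM.1.spectrum_real_eq_range_eigenvalues]
    exact Set.range_nonempty _
  have hmem := hne.csInf_mem (finite_spectrum_of_isHermitian hM.1)
  have hmem' : lamMin M ∈ Set.range hM.1.eigenvalues := by
    rw [← hM.1.spectrum_real_eq_range_eigenvalues]
    exact hmem
  obtain ⟨i, hi⟩ := hmem'
  rw [← hi]
  exact hM.eigenvalues_pos i

lemma sigmaMax_nonneg {m : Type*} [Fintype m] (W : Matrix m n ℝ) : 0 ≤ sigmaMax W :=
  Real.sqrt_nonneg _

lemma sqrt_mulVec_le_sigmaMax {m : Type*} [Fintype m] (W : Matrix m n ℝ) (x : n → ℝ) :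
    Real.sqrt ((W *ᵥ x) ⬝ᵥ (W *ᵥ x)) ≤ sigmaMax W * Real.sqrt (x ⬝ᵥ x) := by
  have hherm : (Wᵀ * W).IsHermitian := by
    simpa using Matrix.isHermitian_conjTranspose_mul_self W
  have hle := dotProduct_mulVec_le_lamMax hherm x
  have hnn : 0 ≤ x ⬝ᵥ x := Finset.sum_nonneg fun i _ => mul_self_nonneg _
  have heq : x ⬝ᵥ ((Wᵀ * W) *ᵥ x) = (W *ᵥ x) ⬝ᵥ (W *ᵥ x) := by
    rw [← Matrix.mulVec_mulVec, Matrix.dotProduct_mulVec, Matrix.vecMul_transpose]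
  rw [sigmaMax, ← Real.sqrt_mul' _ hnn]
  exact Real.sqrt_le_sqrt (heq ▸ hle)

end Spectral

/-! ### The Euclidean norm -/

lemma eucl_nonneg (x : State) : 0 ≤ eucl x := Real.sqrt_nonneg _

lemma eucl_sq (x : State) : eucl x ^ 2 = x ⬝ᵥ x :=
  Real.sq_sqrt (Finset.sum_nonneg fun _ _ => mul_self_nonneg _)

lemma abs_apply_le_eucl (x : State) (i : Fin 4) : |x i| ≤ eucl x := by
  refine Real.abs_le_sqrt ?_
  rw [sq]
  exact Finset.single_le_sum (f := fun j => x j * x j) (fun j _ => mul_self_nonneg _)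
    (Finset.mem_univ i)

lemma eucl_le_of_abs_apply_le {x : State} {c : ℝ} (h : ∀ i, |x i| ≤ c) : eucl x ≤ 2 * c := by
  have hc : 0 ≤ c := (abs_nonneg _).trans (h 0)
  refine Real.sqrt_le_iff.2 ⟨by positivity, ?_⟩
  have : x ⬝ᵥ x ≤ ∑ _i : Fin 4, c ^ 2 :=
    Finset.sum_le_sum fun i _ => by
      rw [← sq]
      exact sq_le_sq' (abs_le.1 (h i)).1 (abs_le.1 (h i)).2
  simp only [Finset.sum_const, Finset.card_univ, Fintype.card_fin, nsmul_eq_mul] at this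
  push_cast at this
  linarith

lemma abs_dotProduct_le_eucl (x y : State) : |x ⬝ᵥ y| ≤ eucl x * eucl y := by
  refine Real.abs_le_sqrt ?_ |>.trans_eq (Real.sqrt_mul ?_ _)
  · have := Finset.sum_mul_sq_le_sq_mul_sq Finset.univ x y
    simpa only [dotProduct, sq] using this
  · exact Finset.sum_nonneg fun _ _ => mul_self_nonneg _

lemma step_apply (A : Matrix (Fin 4) (Fin 4) ℝ) (B : Matrix (Fin 4) (Fin 1) ℝ) (x : State)
    (u : ℝ) (i : Fin 4) : step A B x u i = ∑ j, A i j * x j + B i 0 * u := by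
  simp [step, Matrix.mulVec, dotProduct]

lemma exists_eucl_step_le (A : Matrix (Fin 4) (Fin 4) ℝ) (B : Matrix (Fin 4) (Fin 1) ℝ)
    {C : ℝ} (hC : 0 ≤ C) :
    ∃ L : ℝ, 0 ≤ L ∧ ∀ (x : State) (u : ℝ), |u| ≤ C * eucl x → eucl (step A B x u) ≤ L * eucl x := by
  set S : ℝ := ∑ i, (∑ j, |A i j| + |B i 0| * C) with hS
  have hnn : ∀ i, 0 ≤ ∑ j, |A i j| + |B i 0| * C := fun i =>
    add_nonneg (Finset.sum_nonneg fun _ _ => abs_nonneg _) (mul_nonneg (abs_nonneg _) hC)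
  have hS0 : 0 ≤ S := Finset.sum_nonneg fun i _ => hnn i
  refine ⟨2 * S, by positivity, fun x u hu => ?_⟩
  rw [mul_assoc]
  refine eucl_le_of_abs_apply_le fun i => ?_
  calc |step A B x u i| ≤ ∑ j, |A i j * x j| + |B i 0 * u| := by
        rw [step_apply]
        exact (abs_add_le _ _).trans (add_le_add_left (Finset.abs_sum_le_sum_abs _ _) _)
    _ ≤ ∑ j, |A i j| * eucl x + |B i 0| * (C * eucl x) := by
        gcongr with j
        · rw [abs_mul]
          exact mul_le_mul_of_nonneg_left (abs_apply_le_eucl x j) (abs_nonneg _)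
        · rw [abs_mul]
          exact mul_le_mul_of_nonneg_left hu (abs_nonneg _)
    _ = (∑ j, |A i j| + |B i 0| * C) * eucl x := by
        rw [← Finset.sum_mul]; ring
    _ ≤ S * eucl x := by
        refine mul_le_mul_of_nonneg_right ?_ (eucl_nonneg x)
        exact Finset.single_le_sum (f := fun i => ∑ j, |A i j| + |B i 0| * C)
          (fun i _ => hnn i) (Finset.mem_univ i)

/-! ### The last two coordinates of the discretized model -/

section Discretization

variable (d γ : ℝ)

open NormedSpace in
lemma hasDerivAt_exp_smul_Acont_apply (s : ℝ) (i j : Fin 4) :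
    HasDerivAt (fun s : ℝ => exp (s • Acont d γ) i j)
      ((Acont d γ * exp (s • Acont d γ)) i j) s := by
  open scoped Matrix.Norms.Operator in
  have h := hasDerivAt_exp_smul_const' (𝕂 := ℝ) (Acont d γ) s
  exact hasDerivAt_pi.1 (hasDerivAt_pi.1 h i) j

open NormedSpace in
-- The filter state is autonomous: this row of the exponential satisfies `r' = -r/γ`, so `e^{t/γ} r`
-- is constant.
lemma exp_smul_Acont_three (s : ℝ) (j : Fin 4) :
    exp (s • Acont d γ) 3 j = Real.exp (-(s / γ)) * (1 : Matrix (Fin 4) (Fin 4) ℝ) 3 j := by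
  have hder : ∀ t : ℝ, HasDerivAt (fun t => Real.exp (t / γ) * exp (t • Acont d γ) 3 j) 0 t := by
    intro t
    have h1 : HasDerivAt (fun t : ℝ => Real.exp (t / γ)) (Real.exp (t / γ) * (1 / γ)) t :=
      ((hasDerivAt_id t).div_const γ).exp
    refine (h1.mul (hasDerivAt_exp_smul_Acont_apply d γ t 3 j)).congr_deriv ?_
    simp [Matrix.mul_apply, Fin.sum_univ_four, Acont]
    ring
  have hconst := is_const_of_deriv_eq_zero (fun t => (hder t).differentiableAt)
    (fun t => (hder t).deriv) s 0
  simp only [zero_div, Real.exp_zero, one_mul, zero_smul, exp_zero] at hconst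
  rw [← hconst, ← mul_assoc, ← Real.exp_add]
  simp

open NormedSpace in
-- After multiplication by `e^{t/γ}`, the row of `a_d` is driven by a constant, the row of `η`;
-- subtracting the resulting linear term leaves a constant.
lemma exp_smul_Acont_two (s : ℝ) (j : Fin 4) :
    exp (s • Acont d γ) 2 j = Real.exp (-(s / γ)) * ((1 : Matrix (Fin 4) (Fin 4) ℝ) 2 j +
      s / γ * (1 : Matrix (Fin 4) (Fin 4) ℝ) 3 j) := by
  have hder : ∀ t : ℝ, HasDerivAt (fun t => Real.exp (t / γ) * exp (t • Acont d γ) 2 j -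
      t / γ * (1 : Matrix (Fin 4) (Fin 4) ℝ) 3 j) 0 t := by
    intro t
    have h0 : HasDerivAt (fun t : ℝ => t / γ) (1 / γ) t := (hasDerivAt_id t).div_const γ
    refine ((h0.exp.mul (hasDerivAt_exp_smul_Acont_apply d γ t 2 j)).sub
      (h0.mul_const _)).congr_deriv ?_
    have h3 := exp_smul_Acont_three d γ t j
    have he : Real.exp (t / γ) * Real.exp (-(t / γ)) = 1 := by
      rw [← Real.exp_add]; simp
    simp only [Matrix.mul_apply, Fin.sum_univ_four, h3]
    simp only [Acont, Matrix.of_apply, Matrix.cons_val]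
    linear_combination (1 / γ * (1 : Matrix (Fin 4) (Fin 4) ℝ) 3 j) * he
  have hconst := is_const_of_deriv_eq_zero (fun t => (hder t).differentiableAt)
    (fun t => (hder t).deriv) s 0
  simp only [zero_div, Real.exp_zero, one_mul, zero_smul, exp_zero, zero_mul, sub_zero] at hconst
  rw [← hconst, sub_add_cancel, ← mul_assoc, ← Real.exp_add]
  simp

lemma Bd_three (h : ℝ) : Bd d γ h 3 0 = 1 - alpha h γ := by
  have hint : ∀ s : ℝ, (NormedSpace.exp (s • Acont d γ) * Bcont γ) 3 0 =
      Real.exp (-(s / γ)) * (1 / γ) := by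
    intro s
    simp [Matrix.mul_apply, Fin.sum_univ_four, exp_smul_Acont_three, Bcont]
  simp only [Bd, Matrix.of_apply, hint, alpha]
  have hder : ∀ s : ℝ, HasDerivAt (fun s : ℝ => -Real.exp (-(s / γ)))
      (Real.exp (-(s / γ)) * (1 / γ)) s := fun s =>
    (((hasDerivAt_id s).div_const γ).neg.exp.neg).congr_deriv (by simp)
  rw [intervalIntegral.integral_eq_sub_of_hasDerivAt (fun s _ => hder s)
    (Continuous.intervalIntegrable (by fun_prop) _ _)]
  simp
  ring

lemma Bd_two (h : ℝ) : Bd d γ h 2 0 = 1 - alpha h γ - beta h γ := by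
  have hint : ∀ s : ℝ, (NormedSpace.exp (s • Acont d γ) * Bcont γ) 2 0 =
      Real.exp (-(s / γ)) * (s / γ) * (1 / γ) := by
    intro s
    simp [Matrix.mul_apply, Fin.sum_univ_four, exp_smul_Acont_two, Bcont]
  simp only [Bd, Matrix.of_apply, hint, alpha, beta]
  have hder : ∀ s : ℝ, HasDerivAt (fun s : ℝ => -((1 + s / γ) * Real.exp (-(s / γ))))
      (Real.exp (-(s / γ)) * (s / γ) * (1 / γ)) s := fun s => by
    have h0 : HasDerivAt (fun t : ℝ => t / γ) (1 / γ) s := (hasDerivAt_id s).div_const γ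
    exact (((h0.const_add 1).mul h0.neg.exp).neg).congr_deriv
      (by simp only [Pi.neg_apply]; ring)
  rw [intervalIntegral.integral_eq_sub_of_hasDerivAt (fun s _ => hder s)
    (Continuous.intervalIntegrable (by fun_prop) _ _)]
  simp
  ring

lemma step_apply_three (h : ℝ) (x : State) (u : ℝ) :
    step (Ad d γ h) (Bd d γ h) x u 3 = alpha h γ * x 3 + (1 - alpha h γ) * u := by
  simp [step_apply, Bd_three, Ad, exp_smul_Acont_three, Fin.sum_univ_four, alpha]

lemma step_apply_two (h : ℝ) (x : State) (u : ℝ) :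
    step (Ad d γ h) (Bd d γ h) x u 2 =
      alpha h γ * x 2 + beta h γ * x 3 + (1 - alpha h γ - beta h γ) * u := by
  simp [step_apply, Bd_two, Ad, exp_smul_Acont_two, Fin.sum_univ_four, alpha, beta]
  exact Or.inl (mul_comm _ _)

end Discretization

/-! ### A criterion for uniform global asymptotic stability -/

/-- Summing the decrease bounds the value along a solution by its initial value. The cubic term in
the upper bound is what makes the stability modulus grow only like `ε^{2/3}` for large `ε`. -/
lemma ugas_of_lyapunov {D : ℕ → Set State} {g : ℕ → State → State} (W : ℕ → State → ℝ)
    {q a b : ℝ} (hq : 0 < q) (ha : 0 ≤ a) (hb : 0 ≤ b)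
    (h0 : ∀ k, (0 : State) ∈ D k) (hinv : ∀ k, ∀ x ∈ D k, g k x ∈ D (k + 1))
    (hlow : ∀ k, ∀ x ∈ D k, q * eucl x ^ 2 ≤ W k x)
    (hup : ∀ k, ∀ x ∈ D k, W k x ≤ a * eucl x ^ 2 + b * eucl x ^ 3)
    (hdec : ∀ k, ∀ x ∈ D k, W (k + 1) (g k x) ≤ W k x - q * eucl x ^ 2) :
    UGAS D g := by
  have hsol : ∀ (k₀ : ℕ) (x : ℕ → State), x k₀ ∈ D k₀ → IsSolution g k₀ x →
      ∀ j, x (k₀ + j) ∈ D (k₀ + j) ∧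
        W (k₀ + j) (x (k₀ + j)) ≤
          W k₀ (x k₀) - q * ∑ i ∈ Finset.range j, eucl (x (k₀ + i)) ^ 2 := by
    intro k₀ x hx hs j
    induction j with
    | zero => simpa using hx
    | succ j ih =>
      rw [← add_assoc, hs (k₀ + j) (Nat.le_add_right _ _), Finset.sum_range_succ, mul_add]
      exact ⟨hinv _ _ ih.1, by linarith [hdec _ _ ih.1, ih.2]⟩
  -- If `r ≤ s ε` and `r ≤ s ε^{2/3}` with `s ≤ 1`, both `r²` and `r³` are at most `s² ε²`; then `(a
  -- + b) s² < q` keeps the initial value below `q ε²`.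
  obtain ⟨s, hs0, hs1, hs2⟩ : ∃ s : ℝ, 0 < s ∧ s ≤ 1 ∧ (a + b) * s ^ 2 < q := by
    refine ⟨min 1 (q / (a + b + 1)), by positivity, min_le_left _ _, ?_⟩
    have hm0 : 0 < min 1 (q / (a + b + 1)) := by positivity
    have h1 := min_le_left 1 (q / (a + b + 1))
    have h2 := min_le_right 1 (q / (a + b + 1))
    rw [le_div_iff₀ (by positivity)] at h2
    nlinarith [mul_nonneg (add_nonneg ha hb) hm0.le]
  have hstab : ∀ ε, 0 < ε → ∀ (k₀ : ℕ) (x : ℕ → State), x k₀ ∈ D k₀ → IsSolution g k₀ x →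
      eucl (x k₀) < min (s * ε) (s * ε ^ (2 / 3 : ℝ)) → ∀ k, k₀ ≤ k → eucl (x k) < ε := by
    intro ε hε k₀ x hx hs hlt k hk
    obtain ⟨j, rfl⟩ := Nat.exists_eq_add_of_le hk
    obtain ⟨hm, hW⟩ := hsol k₀ x hx hs j
    have hsum : 0 ≤ q * ∑ i ∈ Finset.range j, eucl (x (k₀ + i)) ^ 2 :=
      mul_nonneg hq.le (Finset.sum_nonneg fun _ _ => sq_nonneg _)
    have hl := hlow _ _ hm
    have hu := hup _ _ hx
    have he := eucl_nonneg (x k₀)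
    have hr2 : eucl (x k₀) ^ 2 ≤ s ^ 2 * ε ^ 2 := by
      rw [← mul_pow]
      exact pow_le_pow_left₀ he (hlt.le.trans (min_le_left _ _)) 2
    have hr3 : eucl (x k₀) ^ 3 ≤ s ^ 2 * ε ^ 2 := by
      calc eucl (x k₀) ^ 3 ≤ (s * ε ^ (2 / 3 : ℝ)) ^ 3 :=
            pow_le_pow_left₀ he (hlt.le.trans (min_le_right _ _)) 3
        _ = s ^ 3 * ε ^ 2 := by
            rw [mul_pow, ← Real.rpow_natCast (ε ^ (2 / 3 : ℝ)), ← Real.rpow_mul hε.le]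
            norm_num
        _ ≤ s ^ 2 * ε ^ 2 :=
            mul_le_mul_of_nonneg_right (pow_le_pow_of_le_one hs0.le hs1 (by norm_num))
              (sq_nonneg _)
    have hsε : (a + b) * s ^ 2 * ε ^ 2 < q * ε ^ 2 :=
      mul_lt_mul_of_pos_right hs2 (by positivity)
    refine lt_of_pow_lt_pow_left₀ 2 hε.le (lt_of_mul_lt_mul_left (a := q) ?_ hq.le)
    linarith [mul_le_mul_of_nonneg_left hr2 ha, mul_le_mul_of_nonneg_left hr3 hb]
  refine ⟨h0, hinv, ⟨fun ε => min (s * ε) (s * ε ^ (2 / 3 : ℝ)), ?_, ?_, hstab⟩, ?_⟩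
  · intro ε hε
    exact lt_min (by positivity) (by positivity)
  · refine Filter.tendsto_atTop.2 fun c => ?_
    have h1 : Filter.Tendsto (fun ε : ℝ => s * ε) Filter.atTop Filter.atTop :=
      Filter.tendsto_id.const_mul_atTop hs0
    have h2 : Filter.Tendsto (fun ε : ℝ => s * ε ^ (2 / 3 : ℝ)) Filter.atTop Filter.atTop :=
      (tendsto_rpow_atTop (by norm_num)).const_mul_atTop hs0
    filter_upwards [Filter.tendsto_atTop.1 h1 c, Filter.tendsto_atTop.1 h2 c] with ε h1 h2
    exact le_min h1 h2
  · intro η c hη hc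
    set r := min (s * η) (s * η ^ (2 / 3 : ℝ)) with hr
    have hr0 : 0 < r := lt_min (by positivity) (by positivity)
    -- Norms staying at least `r` for `T` steps would lower the value by more than its initial bound
    -- and make it negative. So some norm drops below `r` within `T` steps, and stability restarted
    -- there keeps the solution within `η`.
    obtain ⟨T, hT⟩ := exists_nat_gt ((a * c ^ 2 + b * c ^ 3) / (q * r ^ 2))
    rw [div_lt_iff₀ (by positivity)] at hT
    refine ⟨T, fun k₀ x hx hs hlt k hk => ?_⟩
    obtain ⟨i, hi, hri⟩ : ∃ i < T, eucl (x (k₀ + i)) < r := by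
      by_contra! hcon
      obtain ⟨hm, hW⟩ := hsol k₀ x hx hs T
      have hsum : (T : ℝ) * r ^ 2 ≤ ∑ i ∈ Finset.range T, eucl (x (k₀ + i)) ^ 2 := by
        have := Finset.card_nsmul_le_sum (Finset.range T) (fun i => eucl (x (k₀ + i)) ^ 2) (r ^ 2)
          fun i hi => pow_le_pow_left₀ hr0.le (hcon i (Finset.mem_range.1 hi)) 2
        simpa using this
      have hl := (mul_nonneg hq.le (sq_nonneg _)).trans (hlow _ _ hm)
      have hu := hup _ _ hx
      have h2 : eucl (x k₀) ^ 2 ≤ c ^ 2 := pow_le_pow_left₀ (eucl_nonneg _) hlt.le 2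
      have h3 : eucl (x k₀) ^ 3 ≤ c ^ 3 := pow_le_pow_left₀ (eucl_nonneg _) hlt.le 3
      nlinarith [mul_le_mul_of_nonneg_left h2 ha, mul_le_mul_of_nonneg_left h3 hb,
        mul_le_mul_of_nonneg_left hsum hq.le]
    exact hstab η hη (k₀ + i) x (hsol k₀ x hx hs i).1
      (fun k hk => hs k ((Nat.le_add_right _ _).trans hk)) hri k (by omega)

/-! ### Trajectories and their costs -/

section Trajectory

variable (f : State → ℝ → State) (l : State → ℝ → ℝ) (V : State → ℝ)

/-- The trajectory of `x⁺ = f x u` under the infinite input sequence `w`. -/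
def traj (x : State) (w : ℕ → ℝ) : ℕ → State
  | 0 => x
  | i + 1 => f (traj x w i) (w i)

/-- The cost of the first `n` inputs of `w` from `x`. -/
def trajCost (n : ℕ) (x : State) (w : ℕ → ℝ) : ℝ :=
  V (traj f x w n) + ∑ i ∈ Finset.range n, l (traj f x w i) (w i)

variable {f l V}

lemma traj_succ' (x : State) (w : ℕ → ℝ) (n : ℕ) :
    traj f x w (n + 1) = traj f (f x (w 0)) (fun i => w (i + 1)) n := by
  induction n with
  | zero => rfl
  | succ n ih => rw [traj, ih, traj]

lemma trajCost_succ' (x : State) (w : ℕ → ℝ) (n : ℕ) :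
    trajCost f l V (n + 1) x w =
      l x (w 0) + trajCost f l V n (f x (w 0)) (fun i => w (i + 1)) := by
  rw [trajCost, trajCost, Finset.sum_range_succ', traj_succ']
  have h : ∀ i, traj f x w (i + 1) = traj f (f x (w 0)) (fun i => w (i + 1)) i :=
    traj_succ' x w
  simp only [h]
  rw [show traj f x w 0 = x from rfl]
  ring

lemma trajCost_succ_le {x : State} {w : ℕ → ℝ} {n : ℕ}
    (h : V (f (traj f x w n) (w n)) + l (traj f x w n) (w n) ≤ V (traj f x w n)) :
    trajCost f l V (n + 1) x w ≤ trajCost f l V n x w := by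
  rw [trajCost, trajCost, Finset.sum_range_succ, traj]
  linarith

lemma traj_congr {x : State} {w w' : ℕ → ℝ} {n : ℕ} (h : ∀ i < n, w i = w' i) :
    traj f x w n = traj f x w' n := by
  induction n with
  | zero => rfl
  | succ n ih => rw [traj, traj, ih fun i hi => h i (by omega), h n (by omega)]

lemma trajCost_congr {x : State} {w w' : ℕ → ℝ} {n : ℕ} (h : ∀ i < n, w i = w' i) :
    trajCost f l V n x w = trajCost f l V n x w' := by
  rw [trajCost, trajCost, traj_congr h]
  congr 1
  refine Finset.sum_congr rfl fun i hi => ?_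
  have hi' := Finset.mem_range.1 hi
  rw [traj_congr fun j hj => h j (by omega), h i hi']

variable (D : ℕ → ℝ)

/-- The acceleration coordinates of `x` obey the bound at time `k`. -/
def InBox (k : ℕ) (x : State) : Prop := |x 2| ≤ D k ∧ |x 3| ≤ D k

variable (f) in
/-- The input `u` obeys the bound at time `k` and steers `x` into the box of time `k + 1`. -/
def Admissible (k : ℕ) (x : State) (u : ℝ) : Prop := |u| ≤ D k ∧ InBox D (k + 1) (f x u)

variable {D}

/-- A law satisfying the terminal decrease condition yields admissible inputs over every horizon,
at a cost of at most `V`. -/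
lemma exists_admissible_trajCost_le
    (hterm : ∀ k x, InBox D k x → ∃ u, Admissible f D k x u ∧ V (f x u) + l x u ≤ V x)
    (n k : ℕ) (x : State) (hx : InBox D k x) :
    ∃ w : ℕ → ℝ, (∀ i < n, Admissible f D (k + i) (traj f x w i) (w i)) ∧
      trajCost f l V n x w ≤ V x := by
  induction n generalizing k x with
  | zero => exact ⟨0, by simp, by simp [trajCost, traj]⟩
  | succ n ih =>
    obtain ⟨u, hu, hle⟩ := hterm k x hx
    obtain ⟨w, hw, hc⟩ := ih (k + 1) (f x u) hu.2
    refine ⟨fun i => Nat.casesOn i u w, fun i hi => ?_, ?_⟩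
    · cases i with
      | zero => exact hu
      | succ i =>
        rw [traj_succ', show k + (i + 1) = k + 1 + i by ring]
        exact hw i (by omega)
    · rw [trajCost_succ']
      show l x u + trajCost f l V n (f x u) w ≤ V x
      linarith

/-- Dropping the first input of an admissible sequence and appending a terminal one lowers the
cost by at least the first stage cost. -/
lemma exists_shift_trajCost_le
    (hterm : ∀ k x, InBox D k x → ∃ u, Admissible f D k x u ∧ V (f x u) + l x u ≤ V x)
    {n k : ℕ} {x : State} {w : ℕ → ℝ}
    (hw : ∀ i < n + 1, Admissible f D (k + i) (traj f x w i) (w i)) :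
    ∃ w' : ℕ → ℝ,
      (∀ i < n + 1, Admissible f D (k + 1 + i) (traj f (f x (w 0)) w' i) (w' i)) ∧
      trajCost f l V (n + 1) (f x (w 0)) w' ≤ trajCost f l V (n + 1) x w - l x (w 0) := by
  -- Admissibility of the last input `w n` already puts the terminal state in the box of time `k + n
  -- + 1`.
  obtain ⟨u, hu, hle⟩ := hterm (k + (n + 1)) (traj f x w (n + 1)) (hw n (by omega)).2
  -- `v` has `n + 2` relevant inputs. Its last one does not raise the cost, by the terminal
  -- decrease, and removing its first one saves the first stage cost.
  set v : ℕ → ℝ := Function.update w (n + 1) u with hv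
  have hvw : ∀ i < n + 1, w i = v i := fun i hi => by
    rw [hv, Function.update_of_ne (by omega)]
  have hvn : v (n + 1) = u := by rw [hv, Function.update_self]
  have hv0 : v 0 = w 0 := (hvw 0 (by omega)).symm
  refine ⟨fun i => v (i + 1), fun i hi => ?_, ?_⟩
  · rw [← hv0, ← traj_succ', show k + 1 + i = k + (i + 1) by ring]
    have htr : traj f x v (i + 1) = traj f x w (i + 1) :=
      (traj_congr fun j hj => hvw j (by omega)).symm
    rw [htr]
    show Admissible f D (k + (i + 1)) (traj f x w (i + 1)) (v (i + 1))
    rcases Nat.lt_succ_iff_lt_or_eq.1 hi with hlt | rfl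
    · rw [← hvw (i + 1) (by omega)]
      exact hw (i + 1) (by omega)
    · rw [hvn]
      exact hu
  · have h1 := trajCost_succ' (f := f) (l := l) (V := V) x v (n + 1)
    rw [hv0] at h1
    have h2 : trajCost f l V (n + 2) x v ≤ trajCost f l V (n + 1) x v := by
      refine trajCost_succ_le ?_
      rw [hvn, ← traj_congr hvw]
      exact hle
    rw [← trajCost_congr hvw] at h2
    linarith

end Trajectory

/-! ### The terminal cost decreases under the saturated linear feedback -/

/-- The single column of an input matrix. -/
def inputColumn (B : Matrix (Fin 4) (Fin 1) ℝ) : State := fun i => B i 0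

lemma step_eq (A : Matrix (Fin 4) (Fin 4) ℝ) (B : Matrix (Fin 4) (Fin 1) ℝ) (x : State) (u : ℝ) :
    step A B x u = A *ᵥ x + u • inputColumn B := by
  ext i
  simp [step, Matrix.mulVec, dotProduct, inputColumn, mul_comm]

lemma dotProduct_mulVec_comm {M : Matrix (Fin 4) (Fin 4) ℝ} (hM : M.IsHermitian) (x y : State) :
    x ⬝ᵥ (M *ᵥ y) = y ⬝ᵥ (M *ᵥ x) := by
  have hT : Mᵀ = M := by simpa [Matrix.IsHermitian] using hM
  rw [Matrix.dotProduct_mulVec, dotProduct_comm, ← Matrix.mulVec_transpose, hT]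

lemma quad_add_smul {M : Matrix (Fin 4) (Fin 4) ℝ} (hM : M.IsHermitian) (z b : State) (u : ℝ) :
    quad M (z + u • b) = quad M z + 2 * u * (b ⬝ᵥ (M *ᵥ z)) + u ^ 2 * quad M b := by
  have h := dotProduct_mulVec_comm hM z b
  simp only [quad, Matrix.mulVec_add, Matrix.mulVec_smul, dotProduct_add, add_dotProduct,
    smul_dotProduct, dotProduct_smul, smul_eq_mul, h]
  ring

lemma quad_mulVec (A M : Matrix (Fin 4) (Fin 4) ℝ) (x : State) :
    quad M (A *ᵥ x) = quad (Aᵀ * M * A) x := by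
  simp only [quad]
  rw [← Matrix.mulVec_mulVec, ← Matrix.mulVec_mulVec, Matrix.dotProduct_mulVec x,
    Matrix.vecMul_transpose]

lemma quad_sub (M M' : Matrix (Fin 4) (Fin 4) ℝ) (x : State) :
    quad (M - M') x = quad M x - quad M' x := by
  simp [quad, Matrix.sub_mulVec]

lemma quad_nonneg {M : Matrix (Fin 4) (Fin 4) ℝ} (hM : M.PosSemidef) (x : State) :
    0 ≤ quad M x := by
  simpa [quad] using hM.dotProduct_mulVec_nonneg x

/-- `Aᵀ * M * B` has one column, so its largest singular value bounds the norm of that column; the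
rest is Cauchy–Schwarz. -/
lemma abs_column_dotProduct_le (A M : Matrix (Fin 4) (Fin 4) ℝ) (B : Matrix (Fin 4) (Fin 1) ℝ)
    (hM : M.IsHermitian) (x : State) :
    |inputColumn B ⬝ᵥ (M *ᵥ (A *ᵥ x))| ≤ sigmaMax (Aᵀ * M * B) * eucl x := by
  have hw : (Aᵀ * M * B) *ᵥ (fun _ => 1) = Aᵀ *ᵥ (M *ᵥ inputColumn B) := by
    rw [← Matrix.mulVec_mulVec, ← Matrix.mulVec_mulVec]
    congr 2
    ext i
    simp [Matrix.mulVec, dotProduct, inputColumn]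
  have h := sqrt_mulVec_le_sigmaMax (Aᵀ * M * B) (fun _ => 1)
  rw [hw] at h
  have hone : Real.sqrt ((fun _ : Fin 1 => (1 : ℝ)) ⬝ᵥ fun _ => 1) = 1 := by
    simp [dotProduct]
  rw [hone, mul_one] at h
  rw [dotProduct_mulVec_comm hM, dotProduct_comm, Matrix.dotProduct_mulVec,
    ← Matrix.mulVec_transpose]
  exact (abs_dotProduct_le_eucl _ _).trans (mul_le_mul_of_nonneg_right h (eucl_nonneg x))

lemma mul_sqrt_le_rpow_sub_rpow {s t : ℝ} (hs : 0 ≤ s) (hst : s ≤ t) :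
    Real.sqrt t * (t - s) ≤ t ^ (3 / 2 : ℝ) - s ^ (3 / 2 : ℝ) := by
  have h : ∀ r : ℝ, 0 ≤ r → r ^ (3 / 2 : ℝ) = r * Real.sqrt r := by
    intro r hr
    rw [Real.sqrt_eq_rpow, show (3 / 2 : ℝ) = 1 + 1 / 2 by norm_num,
      Real.rpow_add' hr (by norm_num), Real.rpow_one]
  rw [h t (hs.trans hst), h s hs]
  have := mul_le_mul_of_nonneg_left (Real.sqrt_le_sqrt hst) hs
  linarith

/-- Saturating `y` at `±m` scales it by a factor `θ ∈ (0, 1]`. -/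
lemma exists_saturation {m : ℝ} (hm : 0 < m) (y : ℝ) :
    ∃ θ : ℝ, 0 < θ ∧ θ ≤ 1 ∧ |θ * y| ≤ m ∧ (θ = 1 ∨ |θ * y| = m) := by
  by_cases hy : |y| ≤ m
  · exact ⟨1, one_pos, le_rfl, by simpa using hy, Or.inl rfl⟩
  · have hy' : m < |y| := not_le.1 hy
    have hy0 : 0 < |y| := hm.trans hy'
    have habs : |m / |y| * y| = m := by
      rw [abs_mul, abs_div, abs_abs, abs_of_pos hm, div_mul_cancel₀ _ hy0.ne']
    exact ⟨m / |y|, by positivity, (div_le_one hy0).2 hy'.le, habs.le, Or.inr habs⟩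

/-- When saturation is active, `θ|y| = m`, so `θ y² = m|y|`, and `m L ≥ 1` leaves at least `2|y|s`
on the right. -/
lemma saturation_defect_le {θ m L y s : ℝ} (h0 : 0 < θ) (h1 : θ ≤ 1) (hL : 0 ≤ L)
    (hmL : 1 ≤ m * L) (hs : 0 ≤ s) (h : θ = 1 ∨ |θ * y| = m) :
    2 * (1 - θ) * |y| * s ≤ 2 * L * s * (θ * y ^ 2) := by
  rcases h with rfl | h
  · have : 0 ≤ 2 * L * s * (1 * y ^ 2) := by positivity
    simpa using this
  · rw [abs_mul, abs_of_pos h0] at h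
    have hy := abs_nonneg y
    have e : 2 * L * s * (θ * y ^ 2) = 2 * (m * L) * (|y| * s) := by
      rw [← sq_abs y, ← h]; ring
    rw [e]
    have hys : 0 ≤ |y| * s := mul_nonneg hy hs
    nlinarith [mul_le_mul_of_nonneg_right hmL hys]

/-- The input is `θ * y`, where `y = K x` and `θ` saturates it at `m`. The constant `lam` is tuned
so that the cubic decrease covers the saturation defect; what remains is `-Θ‖x‖²`, which covers the
stage cost. -/
lemma exists_termCost_step_le
    {A Q Mc Mq : Matrix (Fin 4) (Fin 4) ℝ} {B : Matrix (Fin 4) (Fin 1) ℝ} {R κ Lu lam Θ m : ℝ}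
    {K : Matrix (Fin 1) (Fin 4) ℝ} (hQ : Q.PosDef) (hR : 0 < R) (hMc : Mc.PosDef)
    (hMcA : (Mc - Aᵀ * Mc * A).PosSemidef) (hκ : 0 < κ)
    (hκB : (1 - κ • (Bᵀ * Mc * B)).PosDef) (hK : K = -(κ • (Bᵀ * Mc * A))) (hMq : Mq.PosDef)
    (hMqA : (A + B * K)ᵀ * Mq * (A + B * K) - Mq = -1)
    (hm : 0 < m) (hLu : 1 ≤ m * Lu)
    (hlam : lam = 2 * κ * Lu * sigmaMax (Aᵀ * Mq * B) / Real.sqrt (lamMin Mc))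
    (hΘ : 0 < Θ)
    (hΘQ : lamMax (Q + (κ ^ 2 * R) • (Aᵀ * Mc * B * Bᵀ * Mc * A)) ≤ Θ) (x : State) :
    ∃ u : ℝ, |u| ≤ m ∧
      termCost Mc Mq lam Θ (step A B x u) + (quad Q x + u * R * u) ≤ termCost Mc Mq lam Θ x := by
  set z : State := A *ᵥ x with hz
  set b : State := inputColumn B with hb
  set y : ℝ := -κ * (b ⬝ᵥ (Mc *ᵥ z)) with hy
  set X : ℝ := eucl x with hX
  set σ : ℝ := sigmaMax (Aᵀ * Mq * B) with hσ
  have hX0 : 0 ≤ X := eucl_nonneg x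
  have hσ0 : 0 ≤ σ := sigmaMax_nonneg _
  have hLu0 : 0 ≤ Lu := by
    by_contra! hneg
    nlinarith [mul_neg_of_pos_of_neg hm hneg]
  have hBv : ∀ v : State, (Bᵀ *ᵥ v) 0 = b ⬝ᵥ v := fun v => by
    simp [hb, inputColumn, Matrix.mulVec, dotProduct]
  have hBKx : (A + B * K) *ᵥ x = z + y • b := by
    rw [Matrix.add_mulVec, ← Matrix.mulVec_mulVec]
    congr 1
    have hKx : (K *ᵥ x) 0 = y := by
      rw [hK, Matrix.neg_mulVec, Matrix.smul_mulVec, ← Matrix.mulVec_mulVec,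
        ← Matrix.mulVec_mulVec]
      simp only [Pi.neg_apply, Pi.smul_apply, smul_eq_mul, hBv, hy, hz]
      ring
    ext i
    rw [Pi.smul_apply, smul_eq_mul, ← hKx]
    simp [Matrix.mulVec, dotProduct, hb, inputColumn, mul_comm]
  -- the quadratic part
  have hq : quad Mq z + 2 * y * (b ⬝ᵥ (Mq *ᵥ z)) + y ^ 2 * quad Mq b = quad Mq x - X ^ 2 := by
    rw [← quad_add_smul hMq.1, ← hBKx, quad_mulVec, eq_add_of_sub_eq hMqA, hX, eucl_sq]
    simp [quad, Matrix.add_mulVec, Matrix.neg_mulVec]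
    ring
  have hp : |b ⬝ᵥ (Mq *ᵥ z)| ≤ σ * X := abs_column_dotProduct_le A Mq B hMq.1 x
  have hqb : 0 ≤ quad Mq b := quad_nonneg hMq.posSemidef b
  -- the cubic part
  have hcz : quad Mc z ≤ quad Mc x := by
    have := quad_nonneg hMcA x
    rw [quad_sub, ← quad_mulVec] at this
    linarith
  have hcb : κ * quad Mc b ≤ 1 := by
    have h := hκB.diag_pos (i := 0)
    have e : (Bᵀ * Mc * B) 0 0 = quad Mc b := by
      rw [quad, ← hBv, Matrix.mul_assoc, Matrix.mul_apply]
      simp [Matrix.mulVec, dotProduct, hb, inputColumn, Matrix.mul_apply]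
    simp only [Matrix.sub_apply, Matrix.one_apply_eq, Matrix.smul_apply, smul_eq_mul, e] at h
    linarith
  have hlm : 0 < lamMin Mc := lamMin_pos hMc
  have hsx : Real.sqrt (lamMin Mc) * X ≤ Real.sqrt (quad Mc x) := by
    rw [hX, eucl, ← Real.sqrt_mul hlm.le]
    exact Real.sqrt_le_sqrt (lamMin_le_dotProduct_mulVec hMc.1 x)
  -- the stage cost
  have hst : quad Q x + R * y ^ 2 ≤ Θ * X ^ 2 := by
    have hMcT : Mcᵀ = Mc := by simpa [Matrix.IsHermitian] using hMc.1
    have hQT : Qᵀ = Q := by simpa [Matrix.IsHermitian] using hQ.1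
    have hherm : (Q + (κ ^ 2 * R) • (Aᵀ * Mc * B * Bᵀ * Mc * A)).IsHermitian := by
      simp [Matrix.IsHermitian, Matrix.conjTranspose_eq_transpose_of_trivial, hMcT, hQT,
        Matrix.mul_assoc]
    have h := dotProduct_mulVec_le_lamMax hherm x
    have e : x ⬝ᵥ ((Aᵀ * Mc * B * Bᵀ * Mc * A) *ᵥ x) = (b ⬝ᵥ (Mc *ᵥ z)) ^ 2 := by
      have e1 : (Aᵀ * Mc * B * Bᵀ * Mc * A) *ᵥ x = Aᵀ *ᵥ (Mc *ᵥ (B *ᵥ (Bᵀ *ᵥ (Mc *ᵥ z)))) := by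
        simp only [hz, Matrix.mulVec_mulVec, Matrix.mul_assoc]
      have e2 : B *ᵥ (Bᵀ *ᵥ (Mc *ᵥ z)) = (b ⬝ᵥ (Mc *ᵥ z)) • b := by
        ext i
        rw [Pi.smul_apply, smul_eq_mul, ← hBv]
        simp [Matrix.mulVec, dotProduct, hb, inputColumn, mul_comm]
      rw [e1, e2, Matrix.dotProduct_mulVec, Matrix.vecMul_transpose, ← hz, Matrix.mulVec_smul,
        dotProduct_smul, dotProduct_mulVec_comm hMc.1, smul_eq_mul, sq]
    rw [Matrix.add_mulVec, Matrix.smul_mulVec, dotProduct_add, dotProduct_smul, e, smul_eq_mul,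
      ← eucl_sq, ← hX] at h
    have := mul_le_mul_of_nonneg_right hΘQ (sq_nonneg X)
    rw [quad]
    calc _ = x ⬝ᵥ (Q *ᵥ x) + κ ^ 2 * R * (b ⬝ᵥ (Mc *ᵥ z)) ^ 2 := by rw [hy]; ring
      _ ≤ _ := h.trans this
  obtain ⟨θ, hθ0, hθ1, hθm, hθ⟩ := exists_saturation hm y
  refine ⟨θ * y, hθm, ?_⟩
  have hdef := saturation_defect_le hθ0 hθ1 hLu0 hLu (mul_nonneg hσ0 hX0) hθ
  have hy2 : (θ * y) ^ 2 ≤ y ^ 2 := by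
    rw [mul_pow]
    exact mul_le_of_le_one_left (sq_nonneg y) (pow_le_one₀ hθ0.le hθ1)
  -- Relative to the full input `y`, the linear term in the input changes by the defect, and the
  -- quadratic term can only shrink since `θ ≤ 1`.
  have hquad : quad Mq (step A B x (θ * y)) ≤ quad Mq x - X ^ 2 + 2 * (1 - θ) * |y| * (σ * X) := by
    rw [step_eq, quad_add_smul hMq.1, ← hz, ← hb]
    have h1 : -(2 * (1 - θ) * y * (b ⬝ᵥ (Mq *ᵥ z))) ≤ 2 * (1 - θ) * |y| * (σ * X) := by
      refine (neg_le_abs _).trans ?_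
      rw [abs_mul, abs_mul, abs_of_nonneg (by linarith : 0 ≤ 2 * (1 - θ))]
      exact mul_le_mul_of_nonneg_left hp
        (mul_nonneg (by linarith) (abs_nonneg y))
    have h2 := mul_le_mul_of_nonneg_right hy2 hqb
    linarith
  -- By the choice of `y` the cross term contributes exactly `-2θy²`; the term quadratic in the
  -- input gives back at most `θy²`, because `κ * quad Mc b ≤ 1`.
  have hcub : κ * quad Mc (step A B x (θ * y)) ≤ κ * quad Mc x - θ * y ^ 2 := by
    rw [step_eq, quad_add_smul hMc.1, ← hz, ← hb]
    have h1 : (θ * y) ^ 2 * (κ * quad Mc b) ≤ θ * y ^ 2 := by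
      calc (θ * y) ^ 2 * (κ * quad Mc b) ≤ (θ * y) ^ 2 :=
            mul_le_of_le_one_right (sq_nonneg _) hcb
        _ = θ * (θ * y ^ 2) := by ring
        _ ≤ θ * y ^ 2 := mul_le_of_le_one_left (by positivity) hθ1
    have h2 : κ * (2 * (θ * y) * (b ⬝ᵥ (Mc *ᵥ z))) = -(2 * (θ * y ^ 2)) := by
      rw [show κ * (2 * (θ * y) * (b ⬝ᵥ (Mc *ᵥ z))) =
        -(2 * (θ * y * (-κ * (b ⬝ᵥ (Mc *ᵥ z))))) by ring, ← hy]
      ring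
    have h3 := mul_le_mul_of_nonneg_left hcz hκ.le
    linarith
  have hc0 : 0 ≤ quad Mc (step A B x (θ * y)) := quad_nonneg hMc.posSemidef _
  have hyθ : 0 ≤ θ * y ^ 2 := by positivity
  have hcle : quad Mc (step A B x (θ * y)) ≤ quad Mc x :=
    le_of_mul_le_mul_left (by linarith) hκ
  have hlam0 : 0 ≤ lam := by rw [hlam]; positivity
  -- By definition `lam * √(lamMin Mc) = 2κ Lu σ`, and `√(lamMin Mc) ‖x‖ ≤ √(quad Mc x)` turns the
  -- linear factor into the slope of the `3/2` power.
  have hcubic : 2 * Lu * (σ * X) * (θ * y ^ 2) ≤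
      lam * (quad Mc x ^ (3 / 2 : ℝ) - quad Mc (step A B x (θ * y)) ^ (3 / 2 : ℝ)) := by
    have hs0 : 0 < Real.sqrt (lamMin Mc) := Real.sqrt_pos.2 hlm
    calc 2 * Lu * (σ * X) * (θ * y ^ 2)
        ≤ 2 * Lu * (σ * X) *
          (κ * (quad Mc x - quad Mc (step A B x (θ * y)))) :=
          mul_le_mul_of_nonneg_left (by linarith) (by positivity)
      _ = lam * (Real.sqrt (lamMin Mc) * X *
          (quad Mc x - quad Mc (step A B x (θ * y)))) := by
          rw [hlam]; field_simp
      _ ≤ lam * (Real.sqrt (quad Mc x) * (quad Mc x - quad Mc (step A B x (θ * y)))) := by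
          gcongr
      _ ≤ _ := mul_le_mul_of_nonneg_left (mul_sqrt_le_rpow_sub_rpow hc0 hcle) hlam0
  have hmain : Θ * (quad Mq (step A B x (θ * y)) +
      lam * quad Mc (step A B x (θ * y)) ^ (3 / 2 : ℝ)) ≤
      Θ * (quad Mq x + lam * quad Mc x ^ (3 / 2 : ℝ) - X ^ 2) :=
    mul_le_mul_of_nonneg_left (by linarith) hΘ.le
  have hRy := mul_le_mul_of_nonneg_left hy2 hR.le
  rw [termCost, termCost]
  linarith

/-! ### The time-varying bounds -/

section Bounds

variable {Δ : ℝ → ℝ} {h γ : ℝ}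

lemma boundAt_eq (Δ : ℝ → ℝ) (h : ℝ) (i k : ℕ) : boundAt Δ h i k = boundAt Δ h 0 (k + i) := by
  simp [boundAt]

/-- Only a weak inequality: `Δ` need not be continuous, so its infimum over an interval may vanish.
-/
lemma boundAt_nonneg (hh : 0 < h) (hΔ : ∀ t, 0 ≤ t → 0 < Δ t) (i k : ℕ) :
    0 ≤ boundAt Δ h i k := by
  refine Real.sInf_nonneg ?_
  rintro _ ⟨t, ht, rfl⟩
  exact (hΔ t (le_trans (by positivity) ht.1)).le

lemma alpha_pos : 0 < alpha h γ := Real.exp_pos _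

lemma beta_pos (hh : 0 < h) (hγ : 0 < γ) : 0 < beta h γ :=
  mul_pos (div_pos hh hγ) (Real.exp_pos _)

lemma alpha_add_beta_lt_one (hh : 0 < h) (hγ : 0 < γ) : alpha h γ + beta h γ < 1 := by
  have hr : 0 < h / γ := div_pos hh hγ
  have h1 := Real.add_one_lt_exp hr.ne'
  have h2 : Real.exp (h / γ) * Real.exp (-(h / γ)) = 1 := by
    rw [← Real.exp_add]; simp
  have h3 := mul_lt_mul_of_pos_right h1 (Real.exp_pos (-(h / γ)))
  rw [alpha, beta]
  linarith

lemma sub_alpha_mul_boundAt_pos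
    (hcond : ∀ k : ℕ, boundAt Δ h 0 (k + 1) > Real.exp (-(h / γ)) * (1 + h / γ) * boundAt Δ h 0 k)
    (k : ℕ) : 0 < boundAt Δ h 0 (k + 1) - (alpha h γ + beta h γ) * boundAt Δ h 0 k := by
  have := hcond k
  rw [alpha, beta]
  linarith

lemma add_deltaStar_le_boundAt (hh : 0 < h) (hγ : 0 < γ) (hΔ : ∀ t, 0 ≤ t → 0 < Δ t)
    (hcond : ∀ k : ℕ, boundAt Δ h 0 (k + 1) > Real.exp (-(h / γ)) * (1 + h / γ) * boundAt Δ h 0 k)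
    (k : ℕ) :
    deltaStar Δ h γ ≤ boundAt Δ h 0 k ∧
    (alpha h γ + beta h γ) * boundAt Δ h 0 k + (1 - alpha h γ - beta h γ) * deltaStar Δ h γ ≤
      boundAt Δ h 0 (k + 1) ∧
    alpha h γ * boundAt Δ h 0 k + (1 - alpha h γ) * deltaStar Δ h γ ≤
      boundAt Δ h 0 (k + 1) := by
  have hab := alpha_add_beta_lt_one hh hγ
  have hb := beta_pos hh hγ
  have hD := boundAt_nonneg hh hΔ 0
  have hpos := sub_alpha_mul_boundAt_pos hcond
  have hpos' : ∀ j, 0 ≤ boundAt Δ h 0 (j + 1) - alpha h γ * boundAt Δ h 0 j := fun j => by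
    linarith [hpos j, mul_nonneg hb.le (hD j)]
  have b1 : BddBelow (Set.range fun j : ℕ =>
      boundAt Δ h 0 (j + 1) - (alpha h γ + beta h γ) * boundAt Δ h 0 j) :=
    ⟨0, by rintro _ ⟨j, rfl⟩; exact (hpos j).le⟩
  have b2 : BddBelow (Set.range fun j : ℕ =>
      boundAt Δ h 0 (j + 1) - alpha h γ * boundAt Δ h 0 j) :=
    ⟨0, by rintro _ ⟨j, rfl⟩; exact hpos' j⟩
  have b3 : BddBelow (Set.range fun j : ℕ => boundAt Δ h 0 j) :=
    ⟨0, by rintro _ ⟨j, rfl⟩; exact hD j⟩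
  have h1 : deltaStar Δ h γ ≤ _ := min_le_left _ _
  have h2 : deltaStar Δ h γ ≤ _ := (min_le_right _ _).trans (min_le_left _ _)
  have h3 : deltaStar Δ h γ ≤ _ := (min_le_right _ _).trans (min_le_right _ _)
  rw [le_inv_mul_iff₀ (by linarith)] at h1 h2
  refine ⟨h3.trans (ciInf_le b3 k), ?_, ?_⟩
  · linarith [ciInf_le b1 k]
  · linarith [ciInf_le b2 k]

lemma deltaStar_nonneg (hh : 0 < h) (hγ : 0 < γ) (hΔ : ∀ t, 0 ≤ t → 0 < Δ t)
    (hcond : ∀ k : ℕ, boundAt Δ h 0 (k + 1) >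
      Real.exp (-(h / γ)) * (1 + h / γ) * boundAt Δ h 0 k) : 0 ≤ deltaStar Δ h γ := by
  have hab := alpha_add_beta_lt_one hh hγ
  have hb := beta_pos hh hγ
  have hD := boundAt_nonneg hh hΔ 0
  have hpos := sub_alpha_mul_boundAt_pos hcond
  refine le_min (mul_nonneg (inv_nonneg.2 (by linarith)) (Real.iInf_nonneg fun j => (hpos j).le))
    (le_min (mul_nonneg (inv_nonneg.2 (by linarith)) (Real.iInf_nonneg fun j => ?_))
      (Real.iInf_nonneg hD))
  linarith [hpos j, mul_nonneg hb.le (hD j)]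

end Bounds

/-! ### Admissible inputs -/

section Admissible

variable {Δ : ℝ → ℝ} {d γ h : ℝ}

/-- The entries of `uMin` and `uMax` are the bounds on the successor's acceleration coordinates
solved for `u`, with positive coefficients `1 - α - β` and `1 - α`. -/
lemma admissible_iff (hh : 0 < h) (hγ : 0 < γ) (i k : ℕ) (x : State) (u : ℝ) :
    Admissible (step (Ad d γ h) (Bd d γ h)) (boundAt Δ h 0) (k + i) x u ↔
      uMin Δ h γ i k x ≤ u ∧ u ≤ uMax Δ h γ i k x := by
  have hab := alpha_add_beta_lt_one hh hγ
  have hb := beta_pos hh hγ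
  have h1 : 0 < 1 - alpha h γ - beta h γ := by linarith
  have h2 : 0 < 1 - alpha h γ := by linarith
  simp only [Admissible, InBox, step_apply_two, step_apply_three, uMin, uMax, boundAt_eq Δ h i k,
    boundAt_eq Δ h (i + 1) k, ← add_assoc, max_le_iff, le_min_iff, neg_le (b := u),
    inv_mul_le_iff₀ h1, le_inv_mul_iff₀ h1, le_inv_mul_iff₀ h2, abs_le]
  constructor
  · rintro ⟨⟨a1, a2⟩, ⟨a3, a4⟩, a5, a6⟩
    refine ⟨⟨?_, ?_, ?_⟩, ?_, ?_, ?_⟩ <;> linarith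
  · rintro ⟨⟨a1, a2, a3⟩, a4, a5, a6⟩
    refine ⟨⟨?_, ?_⟩, ⟨?_, ?_⟩, ?_, ?_⟩ <;> linarith

lemma admissible_of_abs_le_deltaStar (hh : 0 < h) (hγ : 0 < γ) (hΔ : ∀ t, 0 ≤ t → 0 < Δ t)
    (hcond : ∀ k : ℕ, boundAt Δ h 0 (k + 1) > Real.exp (-(h / γ)) * (1 + h / γ) * boundAt Δ h 0 k)
    {k : ℕ} {x : State} {u : ℝ} (hx : InBox (boundAt Δ h 0) k x) (hu : |u| ≤ deltaStar Δ h γ) :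
    Admissible (step (Ad d γ h) (Bd d γ h)) (boundAt Δ h 0) k x u := by
  have hab := alpha_add_beta_lt_one hh hγ
  have hb := beta_pos hh hγ
  have ha : 0 < alpha h γ := alpha_pos
  obtain ⟨c1, c2, c3⟩ := add_deltaStar_le_boundAt hh hγ hΔ hcond k
  obtain ⟨x2, x3⟩ := hx
  refine ⟨hu.trans c1, ?_, ?_⟩
  · rw [step_apply_two]
    refine (abs_add_three _ _ _).trans ?_
    rw [abs_mul, abs_mul, abs_mul, abs_of_pos ha, abs_of_pos hb,
      abs_of_pos (by linarith : 0 < 1 - alpha h γ - beta h γ)]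
    linarith [mul_le_mul_of_nonneg_left x2 ha.le, mul_le_mul_of_nonneg_left x3 hb.le,
      mul_le_mul_of_nonneg_left hu (by linarith : 0 ≤ 1 - alpha h γ - beta h γ)]
  · rw [step_apply_three]
    refine (abs_add_le _ _).trans ?_
    rw [abs_mul, abs_mul, abs_of_pos ha, abs_of_pos (by linarith : 0 < 1 - alpha h γ)]
    linarith [mul_le_mul_of_nonneg_left x3 ha.le,
      mul_le_mul_of_nonneg_left hu (by linarith : 0 ≤ 1 - alpha h γ)]

/-- For `u > 0`, shrinking lowers `a + b u`, which preserves the upper bound, while `|a| ≤ b t`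
keeps the new value nonnegative. The case `u < 0` is symmetric. -/
lemma abs_add_mul_le_of_shrink {a b c u t : ℝ} (hb : 0 < b) (hu : |a + b * u| ≤ c)
    (hta : |a| ≤ b * t) (htu : t ≤ |u|) :
    |a + b * (SignType.sign u * t)| ≤ c := by
  have hc : 0 ≤ c := (abs_nonneg _).trans hu
  have hbt := mul_le_mul_of_nonneg_left htu hb.le
  rw [abs_le] at hu hta ⊢
  rcases lt_trichotomy u 0 with h | rfl | h
  · rw [sign_neg h, SignType.coe_neg_one]
    rw [abs_of_neg h] at hbt
    constructor <;> linarith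
  · simpa using hu
  · rw [sign_pos h, SignType.coe_one]
    rw [abs_of_pos h] at hbt
    constructor <;> linarith

/-- Whenever there is an admissible input, there is one bounded linearly in the state, uniformly
in time. -/
lemma exists_admissible_abs_le (hh : 0 < h) (hγ : 0 < γ) :
    ∃ C : ℝ, 0 ≤ C ∧ ∀ (D : ℕ → ℝ) (k : ℕ) (x : State),
      (∃ u, Admissible (step (Ad d γ h) (Bd d γ h)) D k x u) →
      ∃ u, Admissible (step (Ad d γ h) (Bd d γ h)) D k x u ∧ |u| ≤ C * eucl x := by
  have hab := alpha_add_beta_lt_one hh hγ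
  have hb := beta_pos hh hγ
  have ha : 0 < alpha h γ := alpha_pos
  have h1 : 0 < 1 - alpha h γ - beta h γ := by linarith
  have h2 : 0 < 1 - alpha h γ := by linarith
  -- With this constant the threshold `t` satisfies `(1 - α - β) t = ‖x‖`, enough to dominate the
  -- drift of both acceleration coordinates. A larger input is cut back to size `t` with its sign
  -- kept.
  refine ⟨(1 - alpha h γ - beta h γ)⁻¹, (inv_pos.2 h1).le, ?_⟩
  rintro D k x ⟨u, hu, hu2, hu3⟩
  set t : ℝ := (1 - alpha h γ - beta h γ)⁻¹ * eucl x with ht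
  have hx := eucl_nonneg x
  have ht0 : 0 ≤ t := mul_nonneg (inv_pos.2 h1).le hx
  have hbt : (1 - alpha h γ - beta h γ) * t = eucl x := mul_inv_cancel_left₀ h1.ne' _
  have x2 := mul_le_mul_of_nonneg_left (abs_apply_le_eucl x 2) ha.le
  have x3 := mul_le_mul_of_nonneg_left (abs_apply_le_eucl x 3) hb.le
  have x3' := mul_le_mul_of_nonneg_left (abs_apply_le_eucl x 3) ha.le
  by_cases htu : t ≤ |u|
  · have hsgn : |(SignType.sign u : ℝ) * t| ≤ t := by
      rcases lt_trichotomy u 0 with h | rfl | h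
      · simp [sign_neg h, abs_of_nonneg ht0]
      · simpa using ht0
      · simp [sign_pos h, abs_of_nonneg ht0]
    refine ⟨SignType.sign u * t, ⟨(hsgn.trans htu).trans hu, ?_, ?_⟩, hsgn⟩
    · rw [step_apply_two] at hu2 ⊢
      refine abs_add_mul_le_of_shrink h1 hu2 ?_ htu
      rw [hbt]
      refine (abs_add_le _ _).trans ?_
      rw [abs_mul, abs_mul, abs_of_pos ha, abs_of_pos hb]
      linarith [mul_le_mul_of_nonneg_right hab.le hx]
    · rw [step_apply_three] at hu3 ⊢
      refine abs_add_mul_le_of_shrink h2 hu3 ?_ htu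
      rw [abs_mul, abs_of_pos ha]
      linarith [mul_nonneg hb.le ht0, mul_le_mul_of_nonneg_right hab.le hx, mul_nonneg hb.le hx]
  · exact ⟨u, ⟨hu, hu2, hu3⟩, (not_le.1 htu).le⟩

/-! ### Finite input sequences -/

lemma pred_eq_traj (A : Matrix (Fin 4) (Fin 4) ℝ) (B : Matrix (Fin 4) (Fin 1) ℝ) {N : ℕ}
    (x : State) (U : Fin N → ℝ) (i : ℕ) :
    pred A B x U i = traj (step A B) x (fun j => if hj : j < N then U ⟨j, hj⟩ else 0) i := by
  induction i with
  | zero => rfl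
  | succ i ih => rw [pred, traj, ih]

lemma cost_eq_trajCost (A : Matrix (Fin 4) (Fin 4) ℝ) (B : Matrix (Fin 4) (Fin 1) ℝ)
    (Q : Matrix (Fin 4) (Fin 4) ℝ) (R : ℝ) (V : State → ℝ) {N : ℕ} (x : State) (U : Fin N → ℝ) :
    cost A B Q R V x U = trajCost (step A B) (fun x u => quad Q x + u * R * u) V N x
      (fun j => if hj : j < N then U ⟨j, hj⟩ else 0) := by
  rw [cost, trajCost, pred_eq_traj, ← Fin.sum_univ_eq_sum_range (fun i =>
    quad Q (traj _ x _ i) + _ * R * _)]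
  simp [pred_eq_traj]

lemma feasible_iff (hh : 0 < h) (hγ : 0 < γ) {N : ℕ} (k : ℕ) (x : State) (U : Fin N → ℝ) :
    Feasible Δ d γ h k x U ↔ ∀ i < N, Admissible (step (Ad d γ h) (Bd d γ h)) (boundAt Δ h 0)
      (k + i) (traj (step (Ad d γ h) (Bd d γ h)) x
        (fun j => if hj : j < N then U ⟨j, hj⟩ else 0) i)
      (if hi : i < N then U ⟨i, hi⟩ else 0) := by
  simp only [Feasible, pred_eq_traj]
  constructor
  · intro H i hi
    simpa [hi] using (admissible_iff hh hγ i k _ _).2 (H ⟨i, hi⟩)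
  · intro H i
    simpa using (admissible_iff hh hγ i k _ _).1 (H i i.2)

lemma exists_feasible_cost_eq (hh : 0 < h) (hγ : 0 < γ) (Q : Matrix (Fin 4) (Fin 4) ℝ) (R : ℝ)
    (V : State → ℝ) {N k : ℕ} {x : State} {w : ℕ → ℝ}
    (hw : ∀ i < N, Admissible (step (Ad d γ h) (Bd d γ h)) (boundAt Δ h 0) (k + i)
      (traj (step (Ad d γ h) (Bd d γ h)) x w i) (w i)) :
    ∃ U : Fin N → ℝ, Feasible Δ d γ h k x U ∧
      cost (Ad d γ h) (Bd d γ h) Q R V x U =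
        trajCost (step (Ad d γ h) (Bd d γ h)) (fun x u => quad Q x + u * R * u) V N x w := by
  have hext : ∀ i < N, (if hi : i < N then (fun j : Fin N => w j) ⟨i, hi⟩ else 0) = w i :=
    fun i hi => by simp [hi]
  refine ⟨fun i => w i, (feasible_iff hh hγ k x _).2 fun i hi => ?_, ?_⟩
  · rw [hext i hi, traj_congr fun j hj => hext j (hj.trans hi)]
    exact hw i hi
  · rw [cost_eq_trajCost, trajCost_congr hext]

/-! ### Existence of minimizers -/

lemma continuous_pred (A : Matrix (Fin 4) (Fin 4) ℝ) (B : Matrix (Fin 4) (Fin 1) ℝ) {N : ℕ}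
    (x : State) (i : ℕ) : Continuous fun U : Fin N → ℝ => pred A B x U i := by
  induction i with
  | zero => exact continuous_const
  | succ i ih =>
    have hu : Continuous fun U : Fin N → ℝ => if hi : i < N then U ⟨i, hi⟩ else 0 := by
      split_ifs <;> fun_prop
    refine continuous_pi fun j => ?_
    simp only [pred, step_apply]
    fun_prop

lemma continuous_quad (M : Matrix (Fin 4) (Fin 4) ℝ) : Continuous (quad M) := by
  unfold quad
  fun_prop

lemma continuous_termCost (Mc Mq : Matrix (Fin 4) (Fin 4) ℝ) (lam Θ : ℝ) :
    Continuous (termCost Mc Mq lam Θ) := by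
  unfold termCost
  have h1 := continuous_quad Mc
  have h2 := continuous_quad Mq
  exact continuous_const.mul (h2.add (continuous_const.mul
    (h1.rpow_const fun _ => Or.inr (by norm_num))))

/-- The bounds vary continuously with the input sequence, so the feasible set is closed; the
state-independent entries of `uMin` and `uMax` make it bounded. -/
lemma exists_isOptimal (Q : Matrix (Fin 4) (Fin 4) ℝ) (R : ℝ) {V : State → ℝ} (hV : Continuous V)
    {N k : ℕ} {x : State} (hx : x ∈ feasibleStates Δ d γ h N k) :
    ∃ U : Fin N → ℝ, IsOptimal Δ d γ h Q R V k x U := by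
  have hclosed : IsClosed {U : Fin N → ℝ | Feasible Δ d γ h k x U} := by
    simp only [Feasible, Set.ofPred_forall]
    refine isClosed_iInter fun i => ?_
    have hp := continuous_pred (Ad d γ h) (Bd d γ h) (N := N) x i
    have hmin : Continuous fun U : Fin N → ℝ =>
        uMin Δ h γ i k (pred (Ad d γ h) (Bd d γ h) x U i) := by
      unfold uMin
      fun_prop
    have hmax : Continuous fun U : Fin N → ℝ =>
        uMax Δ h γ i k (pred (Ad d γ h) (Bd d γ h) x U i) := by
      unfold uMax
      fun_prop
    exact (isClosed_le hmin (continuous_apply i)).inter (isClosed_le (continuous_apply i) hmax)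
  have hcompact : IsCompact {U : Fin N → ℝ | Feasible Δ d γ h k x U} := by
    refine (isCompact_Icc (a := fun i : Fin N => -boundAt Δ h i k)
      (b := fun i : Fin N => boundAt Δ h i k)).of_isClosed_subset hclosed fun U hU => ⟨?_, ?_⟩
    · exact fun i => (le_max_left _ _).trans (hU i).1
    · exact fun i => (hU i).2.trans (min_le_left _ _)
  have hcont : Continuous fun U : Fin N → ℝ => cost (Ad d γ h) (Bd d γ h) Q R V x U := by
    unfold cost
    have hp := continuous_pred (Ad d γ h) (Bd d γ h) (N := N) x
    have hq := continuous_quad Q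
    fun_prop
  obtain ⟨U, hU, hmin⟩ := hcompact.exists_isMinOn hx hcont.continuousOn
  exact ⟨U, hU, fun U' hU' => hmin hU'⟩

end Admissible

/-! ### Growth of the costs -/

lemma exists_quad_le (M : Matrix (Fin 4) (Fin 4) ℝ) :
    ∃ c : ℝ, 0 ≤ c ∧ ∀ x, quad M x ≤ c * eucl x ^ 2 := by
  refine ⟨∑ i, ∑ j, |M i j|, Finset.sum_nonneg fun i _ => Finset.sum_nonneg fun j _ =>
    abs_nonneg _, fun x => ?_⟩
  simp only [quad, dotProduct, Matrix.mulVec, Finset.mul_sum, Finset.sum_mul]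
  refine Finset.sum_le_sum fun i _ => Finset.sum_le_sum fun j _ => ?_
  calc x i * (M i j * x j) ≤ |x i * (M i j * x j)| := le_abs_self _
    _ = |M i j| * (|x i| * |x j|) := by rw [abs_mul, abs_mul]; ring
    _ ≤ |M i j| * (eucl x * eucl x) := by
        gcongr
        exacts [eucl_nonneg x, abs_apply_le_eucl x i, abs_apply_le_eucl x j]
    _ = |M i j| * eucl x ^ 2 := by ring

lemma exists_termCost_le {Mc : Matrix (Fin 4) (Fin 4) ℝ} (hMc : Mc.PosSemidef)
    (Mq : Matrix (Fin 4) (Fin 4) ℝ) {lam Θ : ℝ} (hlam : 0 ≤ lam) (hΘ : 0 ≤ Θ) :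
    ∃ a b : ℝ, 0 ≤ a ∧ 0 ≤ b ∧
      ∀ x, termCost Mc Mq lam Θ x ≤ a * eucl x ^ 2 + b * eucl x ^ 3 := by
  obtain ⟨c, hc, hcx⟩ := exists_quad_le Mc
  obtain ⟨q, hq, hqx⟩ := exists_quad_le Mq
  refine ⟨Θ * q, Θ * (lam * c ^ (3 / 2 : ℝ)), by positivity, by positivity, fun x => ?_⟩
  have hx := eucl_nonneg x
  have hpow : quad Mc x ^ (3 / 2 : ℝ) ≤ c ^ (3 / 2 : ℝ) * eucl x ^ 3 := by
    calc quad Mc x ^ (3 / 2 : ℝ) ≤ (c * eucl x ^ 2) ^ (3 / 2 : ℝ) :=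
          Real.rpow_le_rpow (quad_nonneg hMc x) (hcx x) (by norm_num)
      _ = c ^ (3 / 2 : ℝ) * eucl x ^ 3 := by
          rw [Real.mul_rpow hc (by positivity), ← Real.rpow_natCast (eucl x) 2,
            ← Real.rpow_mul hx, ← Real.rpow_natCast (eucl x) 3]
          norm_num
  have h := mul_le_mul_of_nonneg_left
    (add_le_add (hqx x) (mul_le_mul_of_nonneg_left hpow hlam)) hΘ
  rw [termCost]
  linarith

lemma termCost_nonneg {Mc Mq : Matrix (Fin 4) (Fin 4) ℝ} (hMc : Mc.PosSemidef)
    (hMq : Mq.PosSemidef) {lam Θ : ℝ} (hlam : 0 ≤ lam) (hΘ : 0 ≤ Θ) (x : State) :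
    0 ≤ termCost Mc Mq lam Θ x :=
  mul_nonneg hΘ (add_nonneg (quad_nonneg hMq x)
    (mul_nonneg hlam (Real.rpow_nonneg (quad_nonneg hMc x) _)))

/-! ### The optimal value -/

section Value

variable (Δ : ℝ → ℝ) (d γ h : ℝ) (Q : Matrix (Fin 4) (Fin 4) ℝ) (R : ℝ) (V : State → ℝ) (N : ℕ)

/-- The optimal value of the problem at sampling instant `k` from `x`. -/
def optValue (k : ℕ) (x : State) : ℝ :=
  sInf ((fun U : Fin N → ℝ => cost (Ad d γ h) (Bd d γ h) Q R V x U) ''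
    {U | Feasible Δ d γ h k x U})

variable {Δ d γ h Q R V N}

lemma IsOptimal.optValue_eq {k : ℕ} {x : State} {U : Fin N → ℝ}
    (hU : IsOptimal Δ d γ h Q R V k x U) :
    optValue Δ d γ h Q R V N k x = cost (Ad d γ h) (Bd d γ h) Q R V x U := by
  refine IsLeast.csInf_eq ⟨⟨U, hU.1, rfl⟩, ?_⟩
  rintro _ ⟨U', hU', rfl⟩
  exact hU.2 U' hU'

lemma optValue_le_trajCost (hh : 0 < h) (hγ : 0 < γ) (hV : Continuous V) {k : ℕ} {x : State}
    {w : ℕ → ℝ}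
    (hw : ∀ i < N, Admissible (step (Ad d γ h) (Bd d γ h)) (boundAt Δ h 0) (k + i)
      (traj (step (Ad d γ h) (Bd d γ h)) x w i) (w i)) :
    x ∈ feasibleStates Δ d γ h N k ∧ optValue Δ d γ h Q R V N k x ≤
      trajCost (step (Ad d γ h) (Bd d γ h)) (fun x u => quad Q x + u * R * u) V N x w := by
  obtain ⟨U, hU, hc⟩ := exists_feasible_cost_eq hh hγ Q R V hw
  obtain ⟨U', hU'⟩ := exists_isOptimal Q R hV ⟨U, hU⟩
  refine ⟨⟨U, hU⟩, ?_⟩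
  rw [hU'.optValue_eq, ← hc]
  exact hU'.2 U hU

end Value

/-- MPC with a terminal cost that decreases along admissible inputs from the box is uniformly
globally asymptotically stable. -/
lemma IsMPCLaw.ugas {Δ : ℝ → ℝ} {d γ h : ℝ} (hh : 0 < h) (hγ : 0 < γ)
    (hΔ : ∀ t, 0 ≤ t → 0 < Δ t) {Q : Matrix (Fin 4) (Fin 4) ℝ} (hQ : Q.PosDef) {R : ℝ}
    (hR : 0 < R) {V : State → ℝ} (hV : Continuous V) (hV0 : ∀ x, 0 ≤ V x) {a b : ℝ} (ha : 0 ≤ a)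
    (hb : 0 ≤ b) (hVle : ∀ x, V x ≤ a * eucl x ^ 2 + b * eucl x ^ 3)
    (hterm : ∀ k x, InBox (boundAt Δ h 0) k x →
      ∃ u, Admissible (step (Ad d γ h) (Bd d γ h)) (boundAt Δ h 0) k x u ∧
        V (step (Ad d γ h) (Bd d γ h) x u) + (quad Q x + u * R * u) ≤ V x)
    {N : ℕ} {hN : 0 < N} {kN : ℕ → State → ℝ} (hkN : IsMPCLaw Δ d γ h Q R V N hN kN) :
    UGAS (feasibleStates Δ d γ h N) (fun k x => step (Ad d γ h) (Bd d γ h) x (kN k x)) := by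
  obtain ⟨n, rfl⟩ := Nat.exists_eq_succ_of_ne_zero hN.ne'
  set f := step (Ad d γ h) (Bd d γ h) with hf
  have hnext : ∀ k, ∀ x ∈ feasibleStates Δ d γ h (n + 1) k,
      f x (kN k x) ∈ feasibleStates Δ d γ h (n + 1) (k + 1) ∧
      optValue Δ d γ h Q R V (n + 1) (k + 1) (f x (kN k x)) ≤
        optValue Δ d γ h Q R V (n + 1) k x - (quad Q x + kN k x * R * kN k x) := by
    intro k x hx
    obtain ⟨U, hU, hk⟩ := hkN k x hx
    obtain ⟨w', hw', hc⟩ := exists_shift_trajCost_le (l := fun x u => quad Q x + u * R * u)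
      hterm ((feasible_iff hh hγ k x U).1 hU.1)
    rw [← cost_eq_trajCost, ← hU.optValue_eq] at hc
    simp only [hN, dite_true, ← hk] at hw' hc
    obtain ⟨h1, h2⟩ := optValue_le_trajCost (Q := Q) (R := R) hh hγ hV hw'
    exact ⟨h1, h2.trans hc⟩
  obtain ⟨C, hC, hCu⟩ := exists_admissible_abs_le (d := d) hh hγ
  obtain ⟨L, hL, hstep⟩ := exists_eucl_step_le (Ad d γ h) (Bd d γ h) hC
  obtain ⟨c, hc, hQle⟩ := exists_quad_le Q
  have hQpos : ∀ x, 0 ≤ quad Q x := quad_nonneg hQ.posSemidef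
  -- The constants add the stage cost of an input with `|u| ≤ C‖x‖` to the terminal cost at a
  -- successor of norm at most `L‖x‖`.
  refine ugas_of_lyapunov (optValue Δ d γ h Q R V (n + 1)) (q := lamMin Q)
    (a := c + R * C ^ 2 + a * L ^ 2) (b := b * L ^ 3) (lamMin_pos hQ) (by positivity)
    (by positivity) ?_ (fun k x hx => (hnext k x hx).1) ?_ ?_ ?_
  · intro k
    have hbox : InBox (boundAt Δ h 0) k 0 := by
      simpa [InBox] using boundAt_nonneg hh hΔ 0 k
    obtain ⟨w, hw, -⟩ := exists_admissible_trajCost_le hterm (n + 1) k 0 hbox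
    exact (optValue_le_trajCost (Q := Q) (R := R) hh hγ hV hw).1
  · intro k x hx
    obtain ⟨U, hU⟩ := exists_isOptimal Q R hV hx
    have hlow : lamMin Q * eucl x ^ 2 ≤ quad Q x := by
      rw [eucl_sq]
      exact lamMin_le_dotProduct_mulVec hQ.1 x
    refine hlow.trans ?_
    rw [hU.optValue_eq, cost]
    have hsum := Finset.single_le_sum
      (f := fun i : Fin (n + 1) => quad Q (pred (Ad d γ h) (Bd d γ h) x U i) + U i * R * U i)
      (fun i _ => add_nonneg (hQpos _) (by nlinarith [mul_self_nonneg (U i)]))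
      (Finset.mem_univ 0)
    have hu0 : 0 ≤ U 0 * R * U 0 := by nlinarith [mul_self_nonneg (U 0)]
    have hp0 : pred (Ad d γ h) (Bd d γ h) x U ((0 : Fin (n + 1)) : ℕ) = x := rfl
    simp only [hp0] at hsum
    linarith [hV0 (pred (Ad d γ h) (Bd d γ h) x U (n + 1))]
  · rintro k x ⟨U, hU⟩
    -- The first input of a feasible sequence shows that some admissible input exists; it is
    -- replaced by one of linear size, after which the terminal law takes over in the box for the
    -- remaining `n` steps.
    obtain ⟨u, hu, huC⟩ := hCu (boundAt Δ h 0) k x ⟨_, (feasible_iff hh hγ k x U).1 hU 0 hN⟩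
    obtain ⟨w, hw, hwc⟩ := exists_admissible_trajCost_le hterm n (k + 1) (f x u) hu.2
    have hw' : ∀ i < n + 1, Admissible f (boundAt Δ h 0) (k + i)
        (traj f x (fun i => Nat.casesOn i u w) i) (Nat.casesOn i u w) := by
      intro i hi
      cases i with
      | zero => exact hu
      | succ i =>
        rw [traj_succ', show k + (i + 1) = k + 1 + i by ring]
        exact hw i (by omega)
    have hle := (optValue_le_trajCost (Q := Q) (R := R) hh hγ hV hw').2
    rw [trajCost_succ'] at hle
    have hle' : optValue Δ d γ h Q R V (n + 1) k x ≤ (quad Q x + u * R * u) + V (f x u) :=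
      hle.trans (add_le_add_right hwc _)
    have hs := hstep x u huC
    have hs2 := pow_le_pow_left₀ (eucl_nonneg _) hs 2
    have hs3 := pow_le_pow_left₀ (eucl_nonneg _) hs 3
    have hu2 : u ^ 2 ≤ C ^ 2 * eucl x ^ 2 := by
      rw [← mul_pow, ← sq_abs]
      exact pow_le_pow_left₀ (abs_nonneg u) huC 2
    rw [mul_pow] at hs2 hs3
    linarith [hVle (f x u), hQle x, mul_le_mul_of_nonneg_left hu2 hR.le,
      mul_le_mul_of_nonneg_left hs2 ha, mul_le_mul_of_nonneg_left hs3 hb]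
  · intro k x hx
    have hlow : lamMin Q * eucl x ^ 2 ≤ quad Q x := by
      rw [eucl_sq]
      exact lamMin_le_dotProduct_mulVec hQ.1 x
    have hu0 : 0 ≤ kN k x * R * kN k x := by nlinarith [mul_self_nonneg (kN k x)]
    linarith [(hnext k x hx).2]

end AxisMPC

end

theorem theorem4
    -- drag, filter and sampling constants
    (d γ h : ℝ) (hd : 0 < d) (hγ : 0 < γ) (hh : 0 < h)
    -- the time-varying acceleration bound
    (Δ : ℝ → ℝ) (hΔ : ∀ t, 0 ≤ t → 0 < Δ t)
    (hcond : ∀ k : ℕ, AxisMPC.boundAt Δ h 0 (k + 1) >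
      Real.exp (-(h / γ)) * (1 + h / γ) * AxisMPC.boundAt Δ h 0 k)
    -- the stage cost
    (Q : Matrix (Fin 4) (Fin 4) ℝ) (hQ : Q.PosDef) (R : ℝ) (hR : 0 < R)
    -- the matrix `M_c`, the gain `κ`, and the matrix `M_q` belonging to `K = -κ B_dᵀ M_c A_d`
    (Mc : Matrix (Fin 4) (Fin 4) ℝ) (hMc : Mc.PosDef)
    (hMcA : (Mc - (AxisMPC.Ad d γ h)ᵀ * Mc * AxisMPC.Ad d γ h).PosSemidef)
    (κ : ℝ) (hκ : 0 < κ)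
    (hκB : (1 - κ • ((AxisMPC.Bd d γ h)ᵀ * Mc * AxisMPC.Bd d γ h)).PosDef)
    (K : Matrix (Fin 1) (Fin 4) ℝ)
    (hK : K = -(κ • ((AxisMPC.Bd d γ h)ᵀ * Mc * AxisMPC.Ad d γ h)))
    (Mq : Matrix (Fin 4) (Fin 4) ℝ) (hMq : Mq.PosDef)
    (hMqA : (AxisMPC.Ad d γ h + AxisMPC.Bd d γ h * K)ᵀ * Mq *
      (AxisMPC.Ad d γ h + AxisMPC.Bd d γ h * K) - Mq = -1)
    -- the constants `L_u`, `λ` and `Θ`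
    (Lu : ℝ) (hLu : 1 < AxisMPC.deltaStar Δ h γ * Lu)
    (lam : ℝ)
    (hlam : lam = 2 * κ * Lu * AxisMPC.sigmaMax ((AxisMPC.Ad d γ h)ᵀ * Mq * AxisMPC.Bd d γ h) /
      Real.sqrt (AxisMPC.lamMin Mc))
    (Θ : ℝ) (hΘ : 0 < Θ)
    (hΘQ : AxisMPC.lamMax (Q + (κ ^ 2 * R) • ((AxisMPC.Ad d γ h)ᵀ * Mc * AxisMPC.Bd d γ h *
      (AxisMPC.Bd d γ h)ᵀ * Mc * AxisMPC.Ad d γ h)) ≤ Θ)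
    -- the horizon
    (N : ℕ) (hN : 0 < N) :
    (∀ (k : ℕ) (x : AxisMPC.State),
        |x 2| ≤ AxisMPC.boundAt Δ h 0 k → |x 3| ≤ AxisMPC.boundAt Δ h 0 k →
        x ∈ AxisMPC.feasibleStates Δ d γ h N k) ∧
    (∃ kN : ℕ → AxisMPC.State → ℝ,
        AxisMPC.IsMPCLaw Δ d γ h Q R (AxisMPC.termCost Mc Mq lam Θ) N hN kN) ∧
    (∀ kN : ℕ → AxisMPC.State → ℝ,
        AxisMPC.IsMPCLaw Δ d γ h Q R (AxisMPC.termCost Mc Mq lam Θ) N hN kN →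
        AxisMPC.UGAS (AxisMPC.feasibleStates Δ d γ h N)
          (fun k x => AxisMPC.step (AxisMPC.Ad d γ h) (AxisMPC.Bd d γ h) x (kN k x))) := by
  have hm0 := AxisMPC.deltaStar_nonneg hh hγ hΔ hcond
  -- The existence of `Lu` with `Δ* Lu > 1` is what rules out `Δ* = 0`.
  have hm : 0 < AxisMPC.deltaStar Δ h γ := by
    refine lt_of_le_of_ne hm0 fun h0 => ?_
    rw [← h0, zero_mul] at hLu
    linarith
  have hLu0 : 0 ≤ Lu := by
    by_contra! hneg
    linarith [mul_neg_of_pos_of_neg hm hneg]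
  have hlam0 : 0 ≤ lam := by
    have := AxisMPC.sigmaMax_nonneg ((AxisMPC.Ad d γ h)ᵀ * Mq * AxisMPC.Bd d γ h)
    rw [hlam]
    positivity
  have hV := AxisMPC.continuous_termCost Mc Mq lam Θ
  have hterm : ∀ k x, AxisMPC.InBox (AxisMPC.boundAt Δ h 0) k x →
      ∃ u, AxisMPC.Admissible (AxisMPC.step (AxisMPC.Ad d γ h) (AxisMPC.Bd d γ h))
        (AxisMPC.boundAt Δ h 0) k x u ∧
        AxisMPC.termCost Mc Mq lam Θ (AxisMPC.step (AxisMPC.Ad d γ h) (AxisMPC.Bd d γ h) x u) +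
          (AxisMPC.quad Q x + u * R * u) ≤ AxisMPC.termCost Mc Mq lam Θ x := by
    intro k x hx
    obtain ⟨u, hu, hle⟩ := AxisMPC.exists_termCost_step_le hQ hR hMc hMcA hκ hκB hK hMq hMqA hm
      hLu.le hlam hΘ hΘQ x
    exact ⟨u, AxisMPC.admissible_of_abs_le_deltaStar hh hγ hΔ hcond hx hu, hle⟩
  refine ⟨fun k x h2 h3 => ?_, ?_, fun kN hkN => ?_⟩
  · obtain ⟨w, hw, -⟩ := AxisMPC.exists_admissible_trajCost_le hterm N k x ⟨h2, h3⟩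
    exact (AxisMPC.optValue_le_trajCost (Q := Q) (R := R) hh hγ hV hw).1
  · have hex : ∀ k x, ∃ u, x ∈ AxisMPC.feasibleStates Δ d γ h N k →
        ∃ U : Fin N → ℝ, AxisMPC.IsOptimal Δ d γ h Q R (AxisMPC.termCost Mc Mq lam Θ) k x U ∧
          u = U ⟨0, hN⟩ := by
      intro k x
      by_cases hx : x ∈ AxisMPC.feasibleStates Δ d γ h N k
      · obtain ⟨U, hU⟩ := AxisMPC.exists_isOptimal Q R hV hx
        exact ⟨_, fun _ => ⟨U, hU, rfl⟩⟩
      · exact ⟨0, fun hx' => absurd hx' hx⟩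
    choose kN hkN using hex
    exact ⟨kN, hkN⟩
  · obtain ⟨a, b, ha, hb, hVle⟩ :=
      AxisMPC.exists_termCost_le hMc.posSemidef Mq hlam0 hΘ.le
    exact hkN.ugas hh hγ hΔ hQ hR hV
      (AxisMPC.termCost_nonneg hMc.posSemidef hMq.posSemidef hlam0 hΘ.le) ha hb hVle hterm
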